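/- Let $\hat{\mathbb C}=\mathbb C\cup\{\infty\}$. A \emph{domain} is an open connected subset of $\hat{\mathbb C}$; its \emph{boundary components} are the boundaries of the connected components of its complement; it is \emph{finitely connected} if these components are finitely many, \emph{non-degenerate} if each of them has at least two points, and \emph{circular} if its boundary components are circles. For a finitely connected, non-degenerate domain $D$ with $\infty\in D$ and $0\notin D$, let $C_D$ be the circular domain, and $f_D$ the conformal map of $D$ onto $C_D$, such that $f_D(z)=z+O(z^{-1})$ as $z\to\infty$ (by Koebe's theorem both exist and are unique). Call \emph{basic} the open rectangles with sides parallel to the axes and rational vertices and the sets $\hat{\mathbb C}\setminus\overline{D_r(0)}$ with $r>0$ rational, and code them effectively by natural numbers. A \emph{name} of a point $z\in\hat{\mathbb C}$ is an infinite sequence that lists (the codes of) all basic sets containing $z$; a name of an open set $U$ lists all basic sets whose closures are contained in $U$; a name of a closed set $K$ lists all basic sets that intersect $K$. A name of a function $f:\subseteq\hat{\mathbb C}\to\hat{\mathbb C}$ consists of a set $X\subseteq\mathbb N$ and a code of a Turing machine which, with oracle $X$, transforms every name of every $z\in\operatorname{dom}(f)$ into a name of $f(z)$, running indefinitely and writing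 on a one-way output tape. \textbf{Theorem.} From a name of a finitely connected, non-degenerate domain $D$ that contains $\infty$ but not $0$, the number of its boundary components, a name of $f_D$, and a name of $\partial C_D$, one can uniformly compute a name of $\partial D$ (and of $\partial C_D$); that is, there are fixed machines which, for all such $D$ and all such names, transform these data into a name of $\partial D$ and a name of $\partial C_D$, respectively. -/

import Mathlib

open scoped OnePoint

noncomputable section

namespace SphereTTE

/-- The extended complex plane. -/
abbrev Sphere : Type := OnePoint ℂ

/-! ### Machines

Programs for Turing machines with an oracle: the syntax of `Nat.Partrec.Code` together with one
instruction that queries the oracle. -/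

/-- Programs of oracle machines. -/
inductive OracleCode : Type
  | zero : OracleCode
  | succ : OracleCode
  | left : OracleCode
  | right : OracleCode
  | oracle : OracleCode
  | pair : OracleCode → OracleCode → OracleCode
  | comp : OracleCode → OracleCode → OracleCode
  | prec : OracleCode → OracleCode → OracleCode
  | rfind' : OracleCode → OracleCode

namespace OracleCode

/-- The partial function computed by a program with access to `O`. Each clause is the one of
`Nat.Partrec.Code.eval`, and `oracle` returns the queried value of `O`. -/
def eval (O : ℕ → ℕ) : OracleCode → ℕ →. ℕ
  | zero => pure 0
  | succ => Nat.succ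
  | left => ↑fun n : ℕ => n.unpair.1
  | right => ↑fun n : ℕ => n.unpair.2
  | oracle => ↑O
  | pair cf cg => fun n => Nat.pair <$> eval O cf n <*> eval O cg n
  | comp cf cg => fun n => eval O cg n >>= eval O cf
  | prec cf cg =>
    Nat.unpaired fun a n =>
      n.rec (eval O cf a) fun y IH => do
        let i ← IH
        eval O cg (Nat.pair a (Nat.pair y i))
  | rfind' cf =>
    Nat.unpaired fun a m =>
      (Nat.rfind fun n => (fun m => m = 0) <$> eval O cf (Nat.pair a (n + m))).map (· + m)

/-- The number that codes a program (following `Nat.Partrec.Code.encodeCode`). -/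
def encode : OracleCode → ℕ
  | zero => 0
  | succ => 1
  | left => 2
  | right => 3
  | oracle => 4
  | pair cf cg => 2 * (2 * Nat.pair (encode cf) (encode cg)) + 5
  | comp cf cg => 2 * (2 * Nat.pair (encode cf) (encode cg) + 1) + 5
  | prec cf cg => (2 * (2 * Nat.pair (encode cf) (encode cg)) + 1) + 5
  | rfind' cf => (2 * (2 * encode cf + 1) + 1) + 5

/-- When the infinite sequence `O` is on its input tape, the machine with program `c`, running
indefinitely, writes the infinite sequence `s` on its output tape: it delivers each cell `s k`. -/
def Writes (c : OracleCode) (O s : ℕ → ℕ) : Prop :=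
  ∀ k, c.eval O k = Part.some (s k)

end OracleCode

/-- Two infinite sequences on one tape, `p` on the even cells and `q` on the odd cells. -/
def join (p q : ℕ → ℕ) : ℕ → ℕ := fun k => if k % 2 = 0 then p (k / 2) else q (k / 2)

/-- The sequence `p` lists the set `S`: the cell content `n + 1` lists the number `n`, and the
content `0` lists nothing (so that the empty set has a list as well). -/
def Lists (p : ℕ → ℕ) (S : Set ℕ) : Prop :=
  ∀ n, n ∈ S ↔ ∃ k, p k = n + 1

/-! ### Basic open sets and their codes -/

/-- The rational number with code `k`; every rational number has a code. -/
def ratOf (k : ℕ) : ℚ :=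
  ((k.unpair.1.unpair.1 : ℚ) - (k.unpair.1.unpair.2 : ℚ)) / ((k.unpair.2 : ℚ) + 1)

/-- The positive rational number with code `k`; every positive rational number has a code. -/
def posRatOf (k : ℕ) : ℚ :=
  ((k.unpair.1 : ℚ) + 1) / ((k.unpair.2 : ℚ) + 1)

/-- The open rectangle with lower left corner `x + iy`, width `w` and height `h`. -/
def rectangle (x y w h : ℚ) : Set Sphere :=
  (fun z : ℂ => (z : Sphere)) ''
    {z : ℂ | (x : ℝ) < z.re ∧ z.re < (x : ℝ) + (w : ℝ) ∧
      (y : ℝ) < z.im ∧ z.im < (y : ℝ) + (h : ℝ)}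

/-- The complement in the sphere of the closed disk with center `0` and radius `r`. -/
def diskExterior (r : ℚ) : Set Sphere :=
  ((fun z : ℂ => (z : Sphere)) '' Metric.closedBall (0 : ℂ) (r : ℝ))ᶜ

/-- The basic open set with code `k`: even codes are the codes of the rational rectangles, odd
codes those of the disk exteriors with positive rational radius. -/
def basicSet (k : ℕ) : Set Sphere :=
  if k % 2 = 0 then
    rectangle (ratOf (k / 2).unpair.1.unpair.1) (ratOf (k / 2).unpair.1.unpair.2)
      (posRatOf (k / 2).unpair.2.unpair.1) (posRatOf (k / 2).unpair.2.unpair.2)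
  else diskExterior (posRatOf (k / 2))

/-! ### Naming systems -/

/-- A name of a point is a list of all the basic sets that contain it. -/
def NamesPoint (p : ℕ → ℕ) (z : Sphere) : Prop :=
  Lists p {k | z ∈ basicSet k}

/-- A name of an open set is a list of all the basic sets whose closures it contains. -/
def NamesOpen (p : ℕ → ℕ) (U : Set Sphere) : Prop :=
  Lists p {k | closure (basicSet k) ⊆ U}

/-- A name of a closed set is a list of all the basic sets that intersect it. -/
def NamesClosed (p : ℕ → ℕ) (C : Set Sphere) : Prop :=
  Lists p {k | (basicSet k ∩ C).Nonempty}

open Classical in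
/-- The characteristic sequence of a set of natural numbers. -/
def charSeq (X : Set ℕ) : ℕ → ℕ := fun k => if k ∈ X then 1 else 0

/-- The machine with program `c` and oracle `X` computes the function `f` with domain `A`:
from every name of every `z ∈ A` it writes a name of `f z`. -/
def ComputesFun (c : OracleCode) (X : Set ℕ) (A : Set Sphere) (f : Sphere → Sphere) : Prop :=
  ∀ z ∈ A, ∀ p, NamesPoint p z →
    ∃ s, c.Writes (join p (charSeq X)) s ∧ NamesPoint s (f z)

/-- A name of the function `f` with domain `A` consists of an oracle `X` and the code of a machine
that computes `f` from `X`; it is written as that code, followed by the characteristic sequence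
of `X`. -/
def NamesFun (q : ℕ → ℕ) (A : Set Sphere) (f : Sphere → Sphere) : Prop :=
  ∃ (c : OracleCode) (X : Set ℕ),
    q 0 = c.encode ∧ (∀ k, q (k + 1) = charSeq X k) ∧ ComputesFun c X A f

/-! ### Domains of the sphere -/

/-- A domain is an open and connected subset of the sphere. -/
def IsSphereDomain (D : Set Sphere) : Prop := IsOpen D ∧ IsConnected D

/-- The connected components of the complement of `D`. -/
def complComponents (D : Set Sphere) : Set (Set Sphere) :=
  {K | ∃ x ∈ Dᶜ, K = connectedComponentIn Dᶜ x}

/-- The boundary components of `D`: the boundaries of the components of its complement. -/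
def boundaryComponents (D : Set Sphere) : Set (Set Sphere) :=
  frontier '' complComponents D

/-- The complement of `D` has exactly `n` connected components. -/
def IsNConnected (n : ℕ) (D : Set Sphere) : Prop := (complComponents D).encard = n

/-- Each component of the complement of `D` has at least two points. -/
def IsNondegenerate (D : Set Sphere) : Prop := ∀ K ∈ complComponents D, K.Nontrivial

/-- A circular domain is a domain whose boundary components are circles. (It is used for domains
that contain `∞`, so the circles are circles of the plane.) -/
def IsCircularDomain (C : Set Sphere) : Prop :=
  IsSphereDomain C ∧ ∀ Γ ∈ boundaryComponents C, ∃ (a : ℂ) (r : ℝ), 0 < r ∧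
    Γ = (fun z : ℂ => (z : Sphere)) '' Metric.sphere a r

/-! ### Conformal maps -/

/-- A local holomorphic parametrization of the sphere that takes `0` to `p`: it is `w ↦ a + w` if
`p = a` is finite, and `w ↦ 1 / w` if `p = ∞`. -/
def param (p : Sphere) (w : ℂ) : Sphere :=
  p.elim (if w = 0 then ∞ else ((w⁻¹ : ℂ) : Sphere)) (fun a => ((a + w : ℂ) : Sphere))

/-- A local holomorphic coordinate of the sphere near `p`: it is `z` if `p` is finite (the value
at `z = ∞` is irrelevant), and `1 / z` if `p = ∞` (the value at `z = 0` is irrelevant). -/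
def coord (p z : Sphere) : ℂ :=
  p.elim (z.elim 0 fun w => w⁻¹) (fun _ => z.elim 0 fun w => w)

/-- `f` is holomorphic at `p` as a map of the sphere into itself. -/
def HolomorphicAt (f : Sphere → Sphere) (p : Sphere) : Prop :=
  ContinuousAt f p ∧ AnalyticAt ℂ (fun w : ℂ => coord (f p) (f (param p w))) 0

/-- `f` is a conformal map of `D` onto `C`. Only the values of `f` on `D` matter. -/
def IsConformalMap (f : Sphere → Sphere) (D C : Set Sphere) : Prop :=
  (∀ p ∈ D, HolomorphicAt f p) ∧ Set.BijOn f D C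

/-- `f(z) = z + O(1/z)` as `z → ∞`. -/
def IsNormalizedAtInfinity (f : Sphere → Sphere) : Prop :=
  ∃ g : ℂ → ℂ, (∀ᶠ z : ℂ in Bornology.cobounded ℂ, f (z : Sphere) = (g z : Sphere)) ∧
    (fun z => g z - z) =O[Bornology.cobounded ℂ] (fun z => z⁻¹)

/-- `C` is the circular domain `C_D` and `f`, on `D`, is the conformal map `f_D` of `D`
onto `C_D`: the one with `f_D(z) = z + O(1/z)`. -/
def IsKoebeMap (D C : Set Sphere) (f : Sphere → Sphere) : Prop :=
  IsCircularDomain C ∧ IsConformalMap f D C ∧ IsNormalizedAtInfinity f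

end SphereTTE

end

/-! The boundary of `D` is enumerated by searching for finite certificates. Write `f` for the
conformal map. If the disk of radius R about c lies in `D`, and ω lies outside `C`, then `f - ω` is
zero-free and injective on the disk. Koebe distortion then gives |f(z) - f(c)| ≤ K |f(c) - ω| for |z
- c| ≤ R/2, with an absolute constant K (`IsConformalMap.norm_sub_le`). So if f(c) is seen to be
much closer to some ω in ∂C than to f(z), the disk cannot lie in `D`. As its center is in `D`, it
meets ∂D by connectedness (`exists_mem_ball_frontier`). All this is witnessed by finitely many
rational data: rational points m, m' for c, z, disjoint rectangles around their images, and the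
first rectangle meeting ∂C.

Conversely, near any ζ in ∂D such data exist. The sphere is compact, so `f` has a cluster value at
ζ, and it lies on ∂C because `f` is an open injection (`IsConformalMap.exists_mapClusterPt`). Fix a
rational m' near ζ; its image differs from the cluster value ω. Then choose m near ζ with f(m) as
close to ω as needed.

The program for `f` is part of the input, so a universal simulation is required. Oracle queries are
replaced by an ordinary program that knows a finite piece of the tape, and that program is run with
a time bound (`OracleCode.exists_simulation`). The certificate test is then primitive recursive, and
the machine tests one candidate in each output cell. For ∂C the machine copies the given name. -/

namespace SphereTTE

/-! ### Distortion of injective holomorphic functions on disks -/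

open Metric Set Filter Topology

/-- A bounded holomorphic function on a disk covers a disk whose radius is bounded below in terms
of its derivative at the center. -/
theorem ball_subset_image_of_bounded {φ : ℂ → ℂ} {c : ℂ} {R M : ℝ} (hR : 0 < R) (hM : 0 < M)
    (hd : DifferentiableOn ℂ φ (ball c R)) (h0 : φ c = 0) (hb : ∀ z ∈ ball c R, ‖φ z‖ ≤ M)
    (hne : deriv φ c ≠ 0) :
    ball 0 ((‖deriv φ c‖ * R) ^ 2 / (16 * M)) ⊆ φ '' ball c R := by
  set d := ‖deriv φ c‖ * R with hd_def
  have hdpos : 0 < d := mul_pos (norm_pos_iff.2 hne) hR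
  have hcR : c ∈ ball c R := mem_ball_self hR
  have hmaps : MapsTo φ (ball c R) (closedBall (φ c) M) := fun z hz => by
    simpa [h0] using hb z hz
  have hslope : ∀ z ∈ ball c R, ‖dslope φ c z‖ ≤ M / R := fun z hz =>
    Complex.norm_dslope_le_div_of_mapsTo_ball hd hmaps hz
  have hdM : d ≤ M := by
    have := hslope c hcR
    rw [dslope_same, le_div_iff₀ hR] at this
    exact this
  have hgd : DifferentiableOn ℂ (dslope φ c) (ball c R) :=
    (Complex.differentiableOn_dslope (isOpen_ball.mem_nhds hcR)).2 hd
  have hgmaps : MapsTo (dslope φ c) (ball c R) (closedBall (dslope φ c c) (2 * M / R)) := by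
    intro z hz
    rw [mem_closedBall, dist_eq_norm]
    refine (norm_sub_le _ _).trans ?_
    have h1 := hslope z hz
    have h2 := hslope c hcR
    have : 2 * M / R = M / R + M / R := by ring
    linarith
  -- By Schwarz for the difference quotient, its variation on the circle of radius r is at most
  -- 2Mr/R² = d/(2R). With this r that is half of |φ'(c)| = d/R, so |φ| ≥ r · d/(2R) = d²/(8M)
  -- there.
  set r := d * R / (4 * M) with hr_def
  have hr : 0 < r := by positivity
  have hrR : r < R := by
    rw [hr_def, div_lt_iff₀ (by positivity)]
    nlinarith
  have hsub : closedBall c r ⊆ ball c R := closedBall_subset_ball hrR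
  have hlow : ∀ z ∈ sphere c r, d ^ 2 / (8 * M) ≤ ‖φ z - φ c‖ := by
    intro z hz
    have hzR : z ∈ ball c R := hsub (sphere_subset_closedBall hz)
    have hzr : dist z c = r := hz
    have h1 := Complex.dist_le_div_mul_dist_of_mapsTo_ball hgd hgmaps hzR
    rw [dslope_same, hzr, dist_eq_norm, norm_sub_rev] at h1
    have h2 : ‖deriv φ c‖ - ‖dslope φ c z‖ ≤ ‖deriv φ c - dslope φ c z‖ := norm_sub_norm_le _ _
    have h3 : φ z - φ c = (z - c) * dslope φ c z := by
      have := sub_smul_dslope φ c z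
      rw [← this, smul_eq_mul]
    rw [h3, norm_mul, ← dist_eq_norm, hzr]
    have h4 : ‖deriv φ c‖ = d / R := by rw [hd_def]; field_simp
    have h5 : d / R - 2 * M / R / R * r ≤ ‖dslope φ c z‖ := by rw [← h4]; linarith
    have h6 : d ^ 2 / (8 * M) = r * (d / R - 2 * M / R / R * r) := by
      rw [hr_def]; field_simp; ring
    rw [h6]
    exact mul_le_mul_of_nonneg_left h5 hr.le
  have hcl : DiffContOnCl ℂ φ (ball c r) :=
    (hd.mono (by rw [closure_ball c hr.ne']; exact hsub)).diffContOnCl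
  have hfreq : ∃ᶠ z in 𝓝 c, φ z ≠ φ c := by
    have hda : HasDerivAt φ (deriv φ c) c :=
      (hd.differentiableAt (isOpen_ball.mem_nhds hcR)).hasDerivAt
    exact (hda.eventually_ne hne).frequently.filter_mono nhdsWithin_le_nhds
  have := hcl.ball_subset_image_closedBall hr hlow hfreq
  rw [h0] at this
  have heq : d ^ 2 / (16 * M) = d ^ 2 / (8 * M) / 2 := by ring
  rw [heq]
  exact this.trans (image_mono hsub)

/-- If no two values of `φ` have product `1`, then the derivative of `φ` at a zero is bounded. -/
theorem norm_deriv_mul_le_of_mul_ne_one {φ : ℂ → ℂ} {c : ℂ} {R : ℝ} (hR : 0 < R)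
    (hd : DifferentiableOn ℂ φ (ball c R)) (h0 : φ c = 0)
    (hmul : ∀ z ∈ ball c R, ∀ z' ∈ ball c R, φ z * φ z' ≠ 1) :
    ‖deriv φ c‖ * R ≤ 4 := by
  by_contra! hgt
  have hne : deriv φ c ≠ 0 := by
    intro h
    simp [h] at hgt
    linarith
  set d := ‖deriv φ c‖ * R with hd_def
  have hcR : c ∈ ball c R := mem_ball_self hR
  set S : Set ℝ := {s | 0 < s ∧ ball (0 : ℂ) s ⊆ φ '' ball c R} with hS
  -- A value of modulus above 1/s would have its inverse in the covered disk of radius s. Hence |φ|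
  -- ≤ 1/s, and the covering lemma with M = 1/s enlarges s by the factor d²/16. For d > 4 this
  -- exceeds 1, while no covered radius exceeds 1 because 1 · 1 = 1; the supremum of the radii gives
  -- the contradiction.
  have hstep : ∀ s ∈ S, s * (d ^ 2 / 16) ∈ S := by
    rintro s ⟨hs, hsub⟩
    refine ⟨by positivity, ?_⟩
    have hb : ∀ z ∈ ball c R, ‖φ z‖ ≤ 1 / s := by
      intro z hz
      by_contra! hlt
      have hpos : 0 < ‖φ z‖ := lt_trans (by positivity) hlt
      have hmem : (φ z)⁻¹ ∈ ball (0 : ℂ) s := by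
        rw [mem_ball_zero_iff, norm_inv, inv_lt_comm₀ hpos hs]
        simpa using hlt
      obtain ⟨z', hz', he⟩ := hsub hmem
      exact hmul z hz z' hz' (by rw [he]; exact mul_inv_cancel₀ (norm_pos_iff.1 hpos))
    have := ball_subset_image_of_bounded hR (by positivity) hd h0 hb hne
    convert this using 2
    rw [hd_def]
    field_simp
  have hbdd : ∀ s ∈ S, s ≤ 1 := by
    rintro s ⟨hs, hsub⟩
    by_contra! h1
    obtain ⟨z, hz, he⟩ := hsub (show (1 : ℂ) ∈ ball (0 : ℂ) s by simpa using h1)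
    exact hmul z hz z hz (by simp [he])
  have hSne : S.Nonempty := by
    have hda : HasDerivAt φ (deriv φ c) c :=
      (hd.differentiableAt (isOpen_ball.mem_nhds hcR)).hasDerivAt
    have han : AnalyticAt ℂ φ c := hd.analyticAt (isOpen_ball.mem_nhds hcR)
    rcases han.eventually_constant_or_nhds_le_map_nhds with h | h
    · have h1 := (hda.eventually_ne (c := φ c) hne)
      have h2 : ∀ᶠ z in 𝓝[≠] c, φ z = φ c := h.filter_mono nhdsWithin_le_nhds
      obtain ⟨z, hz1, hz2⟩ := (h1.and h2).exists
      exact absurd hz2 hz1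
    · have : φ '' ball c R ∈ 𝓝 (0 : ℂ) := by
        rw [← h0]
        exact h (image_mem_map (isOpen_ball.mem_nhds hcR))
      obtain ⟨s, hs, hsub⟩ := Metric.mem_nhds_iff.1 this
      exact ⟨s, hs, hsub⟩
  have hBA : BddAbove S := ⟨1, hbdd⟩
  have hsup : 0 < sSup S := by
    obtain ⟨s, hs⟩ := hSne
    exact hs.1.trans_le (le_csSup hBA hs)
  have hq : 1 < d ^ 2 / 16 := by
    rw [lt_div_iff₀ (by norm_num)]
    nlinarith
  have hlt : sSup S / (d ^ 2 / 16) < sSup S := div_lt_self hsup hq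
  obtain ⟨s, hs, hs'⟩ := exists_lt_of_lt_csSup hSne hlt
  rw [div_lt_iff₀ (by linarith)] at hs'
  exact absurd (le_csSup hBA (hstep s hs)) (not_le.2 hs')

/-- A zero-free holomorphic function on a disk has a holomorphic logarithm, whose derivative is the
logarithmic derivative. -/
theorem exists_log_on_ball {F : ℂ → ℂ} {c : ℂ} {R : ℝ} (hR : 0 < R)
    (hd : DifferentiableOn ℂ F (ball c R)) (hne : ∀ z ∈ ball c R, F z ≠ 0) :
    ∃ L : ℂ → ℂ, L c = 0 ∧ (∀ z ∈ ball c R, HasDerivAt L (deriv F z / F z) z) ∧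
      ∀ z ∈ ball c R, F z = F c * Complex.exp (L z) := by
  have hcR : c ∈ ball c R := mem_ball_self hR
  have hq : DifferentiableOn ℂ (fun z => deriv F z / F z) (ball c R) :=
    (hd.deriv isOpen_ball).div hd hne
  obtain ⟨L, hLc, hL⟩ := hq.isExactOn_ball.with_val_at c 0
  refine ⟨L, hLc, hL, ?_⟩
  have hda : ∀ z ∈ ball c R, HasDerivAt F (deriv F z) z := fun z hz =>
    (hd.differentiableAt (isOpen_ball.mem_nhds hz)).hasDerivAt
  have hconst : ∀ z ∈ ball c R, HasDerivAt (fun z => F z * Complex.exp (-L z)) 0 z := by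
    intro z hz
    have h1 := (hda z hz).mul ((hL z hz).neg.cexp)
    refine h1.congr_deriv ?_
    have := hne z hz
    field_simp
    ring
  intro z hz
  have h := (convex_ball c R).is_const_of_fderivWithin_eq_zero (𝕜 := ℂ)
    (f := fun z => F z * Complex.exp (-L z))
    (fun z hz => (hconst z hz).differentiableAt.differentiableWithinAt)
    (fun z hz => by
      rw [fderivWithin_of_isOpen isOpen_ball hz]
      ext
      simp [(hconst z hz).deriv]) hz hcR
  simp only [hLc, neg_zero, Complex.exp_zero, mul_one] at h
  rw [← h, mul_assoc, ← Complex.exp_add]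
  simp

/-- A weak form of the Koebe quarter theorem: the logarithmic derivative of a zero-free injective
holomorphic function on a disk. -/
theorem norm_deriv_mul_le_of_injOn {F : ℂ → ℂ} {c : ℂ} {R : ℝ} (hR : 0 < R)
    (hd : DifferentiableOn ℂ F (ball c R)) (hne : ∀ z ∈ ball c R, F z ≠ 0)
    (hinj : InjOn F (ball c R)) :
    ‖deriv F c / F c‖ * R ≤ 16 := by
  have hcR : c ∈ ball c R := mem_ball_self hR
  obtain ⟨L, hLc, hL, hF⟩ := exists_log_on_ball hR hd hne
  -- A square root of F/F(c). Injectivity of F forbids h(z) = -h(z').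
  set h : ℂ → ℂ := fun z => Complex.exp (L z / 2) with hh
  have hsq : ∀ z ∈ ball c R, F z = F c * h z ^ 2 := by
    intro z hz
    rw [hF z hz, hh, sq, ← Complex.exp_add, add_halves]
  have hneg : ∀ z ∈ ball c R, ∀ z' ∈ ball c R, h z + h z' ≠ 0 := by
    intro z hz z' hz' he
    have h1 : h z = -h z' := eq_neg_of_add_eq_zero_left he
    have h2 : F z = F z' := by rw [hsq z hz, hsq z' hz', h1, neg_sq]
    have h3 := hinj hz hz' h2
    subst h3
    have : h z ≠ 0 := Complex.exp_ne_zero _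
    exact this (by linear_combination he / 2)
  have hc1 : h c = 1 := by simp [hh, hLc]
  have hplus : ∀ z ∈ ball c R, h z + 1 ≠ 0 := fun z hz => by
    simpa [hc1] using hneg z hz c hcR
  have hhd : ∀ z ∈ ball c R, HasDerivAt h (h z * (deriv F z / F z / 2)) z := fun z hz =>
    ((hL z hz).div_const 2).cexp
  -- The Cayley transform turns h(z) + h(z') ≠ 0 into φ(z)φ(z') ≠ 1, and φ'(c) = F'(c)/(4F(c)); the
  -- bound 4 for φ becomes 16 for F.
  set φ : ℂ → ℂ := fun z => (h z - 1) / (h z + 1) with hφ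
  have hφd : DifferentiableOn ℂ φ (ball c R) := fun z hz =>
    (((hhd z hz).sub_const 1).div ((hhd z hz).add_const 1)
      (hplus z hz)).differentiableAt.differentiableWithinAt
  have hφc : deriv φ c = deriv F c / F c / 4 := by
    have := (((hhd c hcR).sub_const 1).div ((hhd c hcR).add_const 1) (hplus c hcR)).deriv
    rw [hφ]
    refine this.trans ?_
    rw [hc1]
    ring
  have key := norm_deriv_mul_le_of_mul_ne_one hR hφd (by simp [hφ, hc1]) (by
    intro z hz z' hz' he
    have h1 := hplus z hz
    have h2 := hplus z' hz'
    simp only [hφ] at he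
    field_simp at he
    exact hneg z hz z' hz' (by linear_combination (-1 / 2 : ℂ) * he))
  rw [hφc, norm_div] at key
  norm_num at key
  rw [norm_div]
  linarith

/-- A distortion theorem: an injective zero-free holomorphic function on a disk does not grow too
much between the center and a point halfway to the boundary. -/
theorem norm_le_exp_mul_of_injOn {F : ℂ → ℂ} {c : ℂ} {R : ℝ} (hR : 0 < R)
    (hd : DifferentiableOn ℂ F (ball c R)) (hne : ∀ z ∈ ball c R, F z ≠ 0)
    (hinj : InjOn F (ball c R)) {z : ℂ} (hz : dist z c ≤ R / 2) :
    ‖F z‖ ≤ Real.exp 16 * ‖F c‖ := by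
  obtain ⟨L, hLc, hL, hF⟩ := exists_log_on_ball hR hd hne
  have hsub : closedBall c (R / 2) ⊆ ball c R := closedBall_subset_ball (by linarith)
  -- Each such w is the center of a disk of radius R/2 inside the original one, whence 16/(R/2).
  -- Integrating over a length of at most R/2 gives |L| ≤ 16.
  have hbound : ∀ w ∈ closedBall c (R / 2), ‖deriv F w / F w‖ ≤ 32 / R := by
    intro w hw
    have hww : ball w (R / 2) ⊆ ball c R := by
      refine ball_subset_ball' ?_
      have := mem_closedBall.1 hw
      linarith
    have h1 := norm_deriv_mul_le_of_injOn (half_pos hR) (hd.mono hww)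
      (fun u hu => hne u (hww hu)) (hinj.mono hww)
    rw [le_div_iff₀ hR]
    linarith
  have hmv := (convex_closedBall c (R / 2)).norm_image_sub_le_of_norm_hasDerivWithin_le
    (fun w hw => (hL w (hsub hw)).hasDerivWithinAt) hbound
    (mem_closedBall_self (half_pos hR).le) (mem_closedBall.2 hz)
  rw [hLc, sub_zero, ← dist_eq_norm] at hmv
  have hL16 : ‖L z‖ ≤ 16 := by
    refine hmv.trans ?_
    calc 32 / R * dist z c ≤ 32 / R * (R / 2) := by gcongr
      _ = 16 := by field_simp; norm_num
  rw [hF z (hsub hz), norm_mul, mul_comm, Complex.norm_exp]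
  gcongr
  exact (Complex.re_le_norm _).trans hL16

end SphereTTE

/-! ### Oracle programs: finite use of the tape and universal simulation -/

namespace SphereTTE

open Filter

open Nat.Partrec (Code)

namespace OracleCode

/-- A program without oracle, as a program of an oracle machine. -/
def ofCode : Code → OracleCode
  | .zero => zero
  | .succ => succ
  | .left => left
  | .right => right
  | .pair cf cg => pair (ofCode cf) (ofCode cg)
  | .comp cf cg => comp (ofCode cf) (ofCode cg)
  | .prec cf cg => prec (ofCode cf) (ofCode cg)
  | .rfind' cf => rfind' (ofCode cf)

theorem mem_eval_pair {O : ℕ → ℕ} {cf cg : OracleCode} {n v : ℕ} :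
    v ∈ (pair cf cg).eval O n ↔ ∃ x ∈ cf.eval O n, ∃ y ∈ cg.eval O n, Nat.pair x y = v := by
  change v ∈ ((cf.eval O n).map Nat.pair).bind (fun g => (cg.eval O n).map g) ↔ _
  simp only [Part.mem_bind_iff, Part.mem_map_iff]
  constructor
  · rintro ⟨_, ⟨x, hx, rfl⟩, y, hy, rfl⟩
    exact ⟨x, hx, y, hy, rfl⟩
  · rintro ⟨x, hx, y, hy, rfl⟩
    exact ⟨_, ⟨x, hx, rfl⟩, y, hy, rfl⟩

theorem mem_eval_comp {O : ℕ → ℕ} {cf cg : OracleCode} {n v : ℕ} :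
    v ∈ (comp cf cg).eval O n ↔ ∃ x ∈ cg.eval O n, v ∈ cf.eval O x := by
  exact Part.mem_bind_iff (f := cg.eval O n) (g := cf.eval O)

theorem mem_eval_prec_zero {O : ℕ → ℕ} {cf cg : OracleCode} {a v : ℕ} :
    v ∈ (prec cf cg).eval O (Nat.pair a 0) ↔ v ∈ cf.eval O a := by
  simp only [eval, Nat.unpaired, Nat.unpair_pair]
  exact Iff.rfl

theorem mem_eval_prec_succ {O : ℕ → ℕ} {cf cg : OracleCode} {a m v : ℕ} :
    v ∈ (prec cf cg).eval O (Nat.pair a (m + 1)) ↔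
      ∃ x ∈ (prec cf cg).eval O (Nat.pair a m), v ∈ cg.eval O (Nat.pair a (Nat.pair m x)) := by
  simp only [eval, Nat.unpaired, Nat.unpair_pair]
  exact Part.mem_bind_iff

theorem mem_eval_rfind' {O : ℕ → ℕ} {cf : OracleCode} {n v : ℕ} :
    v ∈ (rfind' cf).eval O n ↔ ∃ x, 0 ∈ cf.eval O (Nat.pair n.unpair.1 (x + n.unpair.2)) ∧
      (∀ m < x, ∃ y ∈ cf.eval O (Nat.pair n.unpair.1 (m + n.unpair.2)), y ≠ 0) ∧
      x + n.unpair.2 = v := by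
  refine (Part.mem_map_iff (f := (· + n.unpair.2)) (o := Nat.rfind fun x =>
    (cf.eval O (Nat.pair n.unpair.1 (x + n.unpair.2))).map (fun m => decide (m = 0)))).trans ?_
  refine exists_congr fun x => ?_
  refine (and_congr_left' Nat.mem_rfind).trans (and_assoc.trans ?_)
  refine and_congr ?_ (and_congr ?_ Iff.rfl)
  · refine (Part.mem_map_iff _).trans ?_
    constructor
    · rintro ⟨y, hy, h⟩
      obtain rfl : y = 0 := by simpa using h
      exact hy
    · exact fun h => ⟨0, h, by simp⟩
  · refine forall_congr' fun m => imp_congr_right fun _ => ?_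
    refine (Part.mem_map_iff _).trans ?_
    simp

theorem mem_eval_ofCode {O : ℕ → ℕ} {c : Code} {n v : ℕ} :
    v ∈ (ofCode c).eval O n ↔ v ∈ c.eval n := by
  suffices h : (ofCode c).eval O = c.eval by rw [h]
  induction c with
  | zero => rfl
  | succ => rfl
  | left => rfl
  | right => rfl
  | pair cf cg hf hg => simp only [ofCode, eval, Code.eval, hf, hg]; rfl
  | comp cf cg hf hg => simp only [ofCode, eval, Code.eval, hf, hg]; rfl
  | prec cf cg hf hg => simp only [ofCode, eval, Code.eval, hf, hg]; rfl
  | rfind' cf hf => simp only [ofCode, eval, Code.eval, hf]; rfl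

theorem exists_mem_eval_of_primrec {f : ℕ → ℕ} (hf : Primrec f) :
    ∃ c : OracleCode, ∀ O n, f n ∈ c.eval O n := by
  obtain ⟨c, hc⟩ := Code.exists_code.1 (Nat.Partrec.of_primrec (Primrec.nat_iff.1 hf))
  refine ⟨ofCode c, fun O n => ?_⟩
  rw [mem_eval_ofCode, hc]
  exact Part.mem_some _

theorem mem_eval_left {O : ℕ → ℕ} {n : ℕ} : n.unpair.1 ∈ left.eval O n :=
  Part.mem_some _

theorem mem_eval_right {O : ℕ → ℕ} {n : ℕ} : n.unpair.2 ∈ right.eval O n :=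
  Part.mem_some _

theorem mem_eval_zero {O : ℕ → ℕ} {n : ℕ} : 0 ∈ zero.eval O n :=
  Part.mem_some _

theorem mem_eval_succ {O : ℕ → ℕ} {n : ℕ} : n + 1 ∈ succ.eval O n :=
  Part.mem_some _

theorem mem_eval_oracle {O : ℕ → ℕ} {n v : ℕ} : v ∈ oracle.eval O n ↔ v = O n :=
  Part.mem_some_iff

/-- The program that reads the first `n.unpair.2` cells of the tape into a list, the last cell
first. -/
def readCells : OracleCode :=
  prec zero (comp succ (pair (comp oracle (comp left right)) (comp right right)))

theorem mem_eval_readCells (O : ℕ → ℕ) (n : ℕ) :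
    Encodable.encode ((List.range n).map O).reverse ∈ readCells.eval O (Nat.pair 0 n) := by
  induction n with
  | zero => exact mem_eval_prec_zero.2 mem_eval_zero
  | succ n ih =>
    refine mem_eval_prec_succ.2 ⟨_, ih, mem_eval_comp.2 ⟨_, mem_eval_pair.2
      ⟨O n, ?_, Encodable.encode ((List.range n).map O).reverse, ?_, rfl⟩, ?_⟩⟩
    · refine mem_eval_comp.2 ⟨n, mem_eval_comp.2 ⟨_, mem_eval_right, ?_⟩, mem_eval_oracle.2 rfl⟩
      simpa using mem_eval_left (O := O)
        (n := Nat.pair n (Encodable.encode ((List.range n).map O).reverse))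
    · refine mem_eval_comp.2 ⟨_, mem_eval_right, ?_⟩
      simpa using mem_eval_right (O := O)
        (n := Nat.pair n (Encodable.encode ((List.range n).map O).reverse))
    -- The code of a list with head a and tail l is the successor of the pair of their codes, so
    -- prepending a cell is `pair` followed by `succ`.
    · rw [List.range_succ, List.map_append, List.reverse_append]
      exact mem_eval_succ

/-- A primitive recursive function of the cell number and of a sufficiently long initial segment of
the input tape is computed by a machine. -/
theorem exists_writes_of_primrec {T : ℕ → List ℕ → ℕ} (hT : Primrec₂ T) :
    ∃ c : OracleCode, ∀ O, c.Writes O fun k => T k ((List.range k.unpair.1).map O) := by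
  let T' : ℕ → ℕ := fun m =>
    T m.unpair.1 ((Encodable.decode (α := List ℕ) m.unpair.2).getD []).reverse
  have hT' : Primrec T' := by
    refine hT.comp (Primrec.fst.comp Primrec.unpair) (Primrec.list_reverse.comp ?_)
    exact Primrec.option_getD.comp (Primrec.decode.comp (Primrec.snd.comp Primrec.unpair))
      (Primrec.const [])
  obtain ⟨c, hc⟩ := exists_mem_eval_of_primrec hT'
  -- `pair left right` is the identity; `readCells` runs on (0, k.unpair.1) and delivers the prefix
  -- in reverse, which `T'` undoes.
  refine ⟨comp c (pair (pair left right) (comp readCells (pair zero left))), fun O k => ?_⟩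
  refine Part.eq_some_iff.2 (mem_eval_comp.2 ⟨_, mem_eval_pair.2
    ⟨k, mem_eval_pair.2 ⟨_, mem_eval_left, _, mem_eval_right, Nat.pair_unpair k⟩, _,
      mem_eval_comp.2 ⟨_, mem_eval_pair.2 ⟨_, mem_eval_zero, _, mem_eval_left, rfl⟩,
        mem_eval_readCells O _⟩, rfl⟩, ?_⟩)
  simpa [T'] using hc O
    (Nat.pair k (Encodable.encode ((List.range k.unpair.1).map O).reverse))

/-! ### Replacing the oracle by a program -/

/-- The program obtained by replacing oracle queries by calls of the program `o`. -/
def subst (o : Code) : OracleCode → Code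
  | zero => .zero
  | succ => .succ
  | left => .left
  | right => .right
  | oracle => o
  | pair cf cg => .pair (subst o cf) (subst o cg)
  | comp cf cg => .comp (subst o cf) (subst o cg)
  | prec cf cg => .prec (subst o cf) (subst o cg)
  | rfind' cf => .rfind' (subst o cf)

/-- The function that `subst` induces on the numbers of programs. -/
def substNat (o : Code) (e : ℕ) : Code :=
  if e = 0 then .zero
  else if e = 1 then .succ
  else if e = 2 then .left
  else if e = 3 then .right
  else if h : e < 5 then o
  else
    have h1 : ((e - 5) / 4).unpair.1 < e :=
      (Nat.unpair_left_le _).trans_lt (by omega)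
    have h2 : ((e - 5) / 4).unpair.2 < e :=
      (Nat.unpair_right_le _).trans_lt (by omega)
    have h3 : (e - 5) / 4 < e := by omega
    if (e - 5) % 4 = 0 then
      .pair (substNat o ((e - 5) / 4).unpair.1) (substNat o ((e - 5) / 4).unpair.2)
    else if (e - 5) % 4 = 2 then
      .comp (substNat o ((e - 5) / 4).unpair.1) (substNat o ((e - 5) / 4).unpair.2)
    else if (e - 5) % 4 = 1 then
      .prec (substNat o ((e - 5) / 4).unpair.1) (substNat o ((e - 5) / 4).unpair.2)
    else .rfind' (substNat o ((e - 5) / 4))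
termination_by e

theorem substNat_encode (o : Code) (c : OracleCode) : substNat o c.encode = subst o c := by
  -- Compound programs have numbers 4P + i + 5, with i = 0, 1, 2, 3 for `pair`, `prec`, `comp`,
  -- `rfind'`.
  have key : ∀ P i : ℕ, i < 4 → (4 * P + i) % 4 = i ∧ (4 * P + i) / 4 = P := by
    intro P i hi; omega
  induction c with
  | zero => rw [substNat]; simp [encode, subst]
  | succ => rw [substNat]; simp [encode, subst]
  | left => rw [substNat]; simp [encode, subst]
  | right => rw [substNat]; simp [encode, subst]
  | oracle => rw [substNat]; simp [encode, subst]
  | pair cf cg hf hg =>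
    rw [substNat]
    have he : (pair cf cg).encode = 4 * Nat.pair cf.encode cg.encode + 0 + 5 := by
      rw [encode]; ring
    rw [he]
    simp [subst, hf, hg]
  | comp cf cg hf hg =>
    rw [substNat]
    have he : (comp cf cg).encode = 4 * Nat.pair cf.encode cg.encode + 2 + 5 := by
      rw [encode]; ring
    rw [he]
    have := key (Nat.pair cf.encode cg.encode) 2 (by norm_num)
    simp [this, subst, hf, hg]
  | prec cf cg hf hg =>
    rw [substNat]
    have he : (prec cf cg).encode = 4 * Nat.pair cf.encode cg.encode + 1 + 5 := by
      rw [encode]; ring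
    rw [he]
    have := key (Nat.pair cf.encode cg.encode) 1 (by norm_num)
    simp [this, subst, hf, hg]
  | rfind' cf hf =>
    rw [substNat]
    have he : (rfind' cf).encode = 4 * cf.encode + 3 + 5 := by
      rw [encode]; ring
    rw [he]
    have := key cf.encode 3 (by norm_num)
    simp [this, subst, hf]

/-- Course-of-values recursion: the list `l` holds the values at all smaller numbers, so its length
is the current number and the subprograms are found by indexing. In the `rfind'` case the two
unpaired entries are looked up as well, which is harmless because their indices are in range. -/
theorem primrec₂_substNat : Primrec₂ substNat := by
  let g : Code → List Code → Option Code := fun o l =>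
    if l.length = 0 then some .zero
    else if l.length = 1 then some .succ
    else if l.length = 2 then some .left
    else if l.length = 3 then some .right
    else if l.length < 5 then some o
    else (l[((l.length - 5) / 4).unpair.1]?).bind fun a =>
      (l[((l.length - 5) / 4).unpair.2]?).bind fun b =>
        if (l.length - 5) % 4 = 0 then some (.pair a b)
        else if (l.length - 5) % 4 = 2 then some (.comp a b)
        else if (l.length - 5) % 4 = 1 then some (.prec a b)
        else (l[(l.length - 5) / 4]?).map .rfind'
  have hlen : Primrec fun p : Code × List Code => p.2.length :=
    Primrec.list_length.comp Primrec.snd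
  have hdiv : Primrec fun p : Code × List Code => (p.2.length - 5) / 4 :=
    Primrec.nat_div.comp (Primrec.nat_sub.comp hlen (Primrec.const 5)) (Primrec.const 4)
  have hmod : Primrec fun p : Code × List Code => (p.2.length - 5) % 4 :=
    Primrec.nat_mod.comp (Primrec.nat_sub.comp hlen (Primrec.const 5)) (Primrec.const 4)
  have hg : Primrec₂ g := by
    refine .ite (Primrec.eq.comp hlen (.const 0)) (.const _) ?_
    refine .ite (Primrec.eq.comp hlen (.const 1)) (.const _) ?_
    refine .ite (Primrec.eq.comp hlen (.const 2)) (.const _) ?_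
    refine .ite (Primrec.eq.comp hlen (.const 3)) (.const _) ?_
    refine .ite (Primrec.nat_lt.comp hlen (.const 5)) (Primrec.option_some.comp .fst) ?_
    refine Primrec.option_bind (Primrec.list_getElem?.comp .snd
      (Primrec.fst.comp (Primrec.unpair.comp hdiv))) ?_
    refine Primrec.option_bind (Primrec.list_getElem?.comp (Primrec.snd.comp .fst)
      (Primrec.snd.comp (Primrec.unpair.comp (hdiv.comp .fst)))) ?_
    have hm := hmod.comp (Primrec.fst.comp
      (Primrec.fst (α := (Code × List Code) × Code) (β := Code)))
    refine .ite (Primrec.eq.comp hm (.const 0))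
      (Primrec.option_some.comp (Code.primrec₂_pair.comp (Primrec.snd.comp .fst) .snd)) ?_
    refine .ite (Primrec.eq.comp hm (.const 2))
      (Primrec.option_some.comp (Code.primrec₂_comp.comp (Primrec.snd.comp .fst) .snd)) ?_
    refine .ite (Primrec.eq.comp hm (.const 1))
      (Primrec.option_some.comp (Code.primrec₂_prec.comp (Primrec.snd.comp .fst) .snd)) ?_
    exact Primrec.option_map (Primrec.list_getElem?.comp
      (Primrec.snd.comp (Primrec.fst.comp .fst)) (hdiv.comp (Primrec.fst.comp .fst)))
      (Code.primrec_rfind'.comp .snd)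
  refine Primrec.nat_strong_rec substNat hg fun o n => ?_
  have hget : ∀ m < n, ((List.range n).map (substNat o))[m]? = some (substNat o m) := by
    intro m hm
    simp [hm]
  rw [substNat]
  simp only [g, List.length_map, List.length_range]
  split_ifs with h0 h1 h2 h3 h4 h5 h6 h7 <;> try rfl
  all_goals
    rw [hget _ ((Nat.unpair_left_le _).trans_lt (by omega)),
      hget _ ((Nat.unpair_right_le _).trans_lt (by omega))]
    simp only [Option.bind_some]
  rw [hget _ (by omega)]
  rfl

/-- The program `o` may diverge; it only must never answer wrongly. Evaluation is monotone in the
oracle, as even the failed trials of `rfind'` have to converge. -/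
theorem mem_eval_of_mem_eval_subst {o : Code} {O : ℕ → ℕ} (ho : ∀ n, ∀ v ∈ o.eval n, v = O n)
    (c : OracleCode) : ∀ n, ∀ v ∈ (ofCode (subst o c)).eval O n, v ∈ c.eval O n := by
  induction c with
  | zero => exact fun n v h => h
  | succ => exact fun n v h => h
  | left => exact fun n v h => h
  | right => exact fun n v h => h
  | oracle => exact fun n v h => mem_eval_oracle.2 (ho n v (mem_eval_ofCode.1 h))
  | pair cf cg hf hg =>
    intro n v h
    obtain ⟨x, hx, y, hy, rfl⟩ := mem_eval_pair.1 h
    exact mem_eval_pair.2 ⟨x, hf _ _ hx, y, hg _ _ hy, rfl⟩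
  | comp cf cg hf hg =>
    intro n v h
    obtain ⟨x, hx, hv⟩ := mem_eval_comp.1 h
    exact mem_eval_comp.2 ⟨x, hg _ _ hx, hf _ _ hv⟩
  | prec cf cg hf hg =>
    intro n
    rw [← Nat.pair_unpair n]
    induction n.unpair.2 with
    | zero => exact fun v h => mem_eval_prec_zero.2 (hf _ _ (mem_eval_prec_zero.1 h))
    | succ m ih =>
      intro v h
      obtain ⟨x, hx, hv⟩ := mem_eval_prec_succ.1 h
      exact mem_eval_prec_succ.2 ⟨x, ih _ hx, hg _ _ hv⟩
  | rfind' cf hf =>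
    intro n v h
    obtain ⟨x, h1, h2, rfl⟩ := mem_eval_rfind'.1 h
    refine mem_eval_rfind'.2 ⟨x, hf _ _ h1, fun m hm => ?_, rfl⟩
    obtain ⟨y, hy, hy'⟩ := h2 m hm
    exact ⟨y, hf _ _ hy, hy'⟩

/-- A halting computation needs only finitely many values of the oracle. -/
theorem eventually_mem_eval_subst {o : ℕ → Code} {O : ℕ → ℕ}
    (ho : ∀ n, ∀ᶠ N in atTop, O n ∈ (o N).eval n) (c : OracleCode) :
    ∀ n, ∀ v ∈ c.eval O n, ∀ᶠ N in atTop, v ∈ (ofCode (subst (o N) c)).eval O n := by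
  induction c with
  | zero => exact fun n v h => .of_forall fun _ => h
  | succ => exact fun n v h => .of_forall fun _ => h
  | left => exact fun n v h => .of_forall fun _ => h
  | right => exact fun n v h => .of_forall fun _ => h
  | oracle =>
    intro n v h
    obtain rfl := mem_eval_oracle.1 h
    exact (ho n).mono fun N hN => mem_eval_ofCode.2 hN
  | pair cf cg hf hg =>
    intro n v h
    obtain ⟨x, hx, y, hy, rfl⟩ := mem_eval_pair.1 h
    filter_upwards [hf _ _ hx, hg _ _ hy] with N h1 h2
    exact mem_eval_pair.2 ⟨x, h1, y, h2, rfl⟩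
  | comp cf cg hf hg =>
    intro n v h
    obtain ⟨x, hx, hv⟩ := mem_eval_comp.1 h
    filter_upwards [hg _ _ hx, hf _ _ hv] with N h1 h2
    exact mem_eval_comp.2 ⟨x, h1, h2⟩
  | prec cf cg hf hg =>
    intro n
    rw [← Nat.pair_unpair n]
    induction n.unpair.2 with
    | zero =>
      exact fun v h => (hf _ _ (mem_eval_prec_zero.1 h)).mono fun N hN => mem_eval_prec_zero.2 hN
    | succ m ih =>
      intro v h
      obtain ⟨x, hx, hv⟩ := mem_eval_prec_succ.1 h
      filter_upwards [ih _ hx, hg _ _ hv] with N h1 h2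
      exact mem_eval_prec_succ.2 ⟨x, h1, h2⟩
  | rfind' cf hf =>
    intro n v h
    obtain ⟨x, h1, h2, rfl⟩ := mem_eval_rfind'.1 h
    -- Only finitely many trials precede the first zero, so their eventual conditions hold
    -- simultaneously.
    have h2' : ∀ m ∈ Set.Iio x, ∀ᶠ N in atTop, ∃ y ∈ (ofCode (subst (o N) cf)).eval O
        (Nat.pair n.unpair.1 (m + n.unpair.2)), y ≠ 0 := by
      intro m hm
      obtain ⟨y, hy, hy'⟩ := h2 m hm
      filter_upwards [hf _ _ hy] with N h
      exact ⟨y, h, hy'⟩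
    filter_upwards [hf _ _ h1, (eventually_all_finite (Set.finite_Iio x)).2 h2'] with N h3 h4
    exact mem_eval_rfind'.2 ⟨x, h3, h4, rfl⟩

/-- The bounded simulation of oracle machines, when a finite piece `s` of information about the
oracle is given, is primitive recursive. -/
theorem exists_simulation {σ : Type*} [Primcodable σ] {orc : σ → ℕ → Option ℕ}
    (horc : Primrec₂ orc) :
    ∃ sim : σ → ℕ → ℕ → ℕ → Option ℕ,
      (Primrec fun a : σ × ℕ × ℕ × ℕ => sim a.1 a.2.1 a.2.2.1 a.2.2.2) ∧
      (∀ (s : σ) (O : ℕ → ℕ) (c : OracleCode), (∀ n v, orc s n = some v → v = O n) →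
        ∀ t n v, sim s t c.encode n = some v → v ∈ c.eval O n) ∧
      ∀ (s : ℕ → σ) (O : ℕ → ℕ) (c : OracleCode),
        (∀ n, ∀ᶠ N in atTop, orc (s N) n = some (O n)) →
        ∀ n, ∀ v ∈ c.eval O n, ∀ᶠ N in atTop, ∃ t, sim (s N) t c.encode n = some v := by
  have hpart : Nat.Partrec fun m : ℕ =>
      (↑((Encodable.decode (α := σ) m.unpair.1).bind fun s => orc s m.unpair.2) : Part ℕ) := by
    refine Partrec.nat_iff.1 (Computable.ofOption (Primrec.to_comp ?_))
    exact Primrec.option_bind (Primrec.decode.comp (Primrec.fst.comp .unpair))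
      (horc.comp .snd (Primrec.snd.comp (Primrec.unpair.comp .fst)))
  obtain ⟨o, ho⟩ := Code.exists_code.1 hpart
  have heval : ∀ (s : σ) n, (o.curry (Encodable.encode s)).eval n = ↑(orc s n) := by
    intro s n
    rw [Code.eval_curry, ho]
    simp
  -- One program `o` answers queries for every piece of information; currying fixes `s`, and `evaln`
  -- bounds the running time by `t`.
  refine ⟨fun s t e n => (substNat (o.curry (Encodable.encode s)) e).evaln t n, ?_, ?_, ?_⟩
  · refine Code.primrec_evaln.comp (.pair (.pair (Primrec.fst.comp .snd) ?_)
      (Primrec.snd.comp (Primrec.snd.comp .snd)))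
    exact primrec₂_substNat.comp
      (Code.primrec₂_curry.comp (.const o) (Primrec.encode.comp .fst))
      (Primrec.fst.comp (Primrec.snd.comp .snd))
  · intro s O c hO t n v hv
    simp only [substNat_encode] at hv
    refine mem_eval_of_mem_eval_subst ?_ c n v (mem_eval_ofCode.2 (Code.evaln_sound hv))
    intro m w hw
    rw [heval] at hw
    exact hO m w (by simpa using hw)
  · intro s O c hO n v hv
    have := eventually_mem_eval_subst (o := fun N => o.curry (Encodable.encode (s N))) (O := O)
      (fun m => by
        filter_upwards [hO m] with N hN
        rw [heval, hN]
        simp) c n v hv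
    filter_upwards [this] with N hN
    obtain ⟨t, ht⟩ := Code.evaln_complete.1 (mem_eval_ofCode.1 hN)
    exact ⟨t, by simp only [substNat_encode]; exact ht⟩

end OracleCode

end SphereTTE

namespace SphereTTE

/-! ### Effective rational arithmetic -/

theorem ratOf_pair (a b c : ℕ) :
    ratOf (Nat.pair (Nat.pair a b) c) = ((a : ℚ) - b) / (c + 1) := by
  simp [ratOf]

theorem ratOf_surjective : Function.Surjective ratOf := by
  intro q
  refine ⟨Nat.pair (Nat.pair q.num.toNat (-q.num).toNat) (q.den - 1), ?_⟩
  rw [ratOf_pair]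
  have h1 : ((q.num.toNat : ℚ) - ((-q.num).toNat : ℚ)) = q.num := by
    have : (q.num.toNat : ℤ) - ((-q.num).toNat : ℤ) = q.num := by omega
    exact_mod_cast this
  have h2 : ((q.den - 1 : ℕ) : ℚ) + 1 = q.den := by
    have := q.den_pos
    have h : (q.den - 1) + 1 = q.den := by omega
    exact_mod_cast h
  rw [h1, h2, Rat.num_div_den]

theorem exists_posRatOf_eq {q : ℚ} (hq : 0 < q) : ∃ k, posRatOf k = q := by
  refine ⟨Nat.pair (q.num.toNat - 1) (q.den - 1), ?_⟩
  simp only [posRatOf, Nat.unpair_pair]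
  have hn := Rat.num_pos.2 hq
  have h1 : ((q.num.toNat - 1 : ℕ) : ℚ) + 1 = q.num := by
    have : ((q.num.toNat - 1 : ℕ) : ℤ) + 1 = q.num := by omega
    exact_mod_cast this
  have h2 : ((q.den - 1 : ℕ) : ℚ) + 1 = q.den := by
    have := q.den_pos
    have h : (q.den - 1) + 1 = q.den := by omega
    exact_mod_cast h
  rw [h1, h2, Rat.num_div_den]

theorem posRatOf_pos (k : ℕ) : 0 < posRatOf k := by
  rw [posRatOf]
  positivity

section RatPrimrec

variable {α : Type*} [Primcodable α]

/-- A primitive recursive function with rational values: numerators and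
denominators of the values can be computed. -/
def RatPrimrec (q : α → ℚ) : Prop :=
  ∃ a b c : α → ℕ, Primrec a ∧ Primrec b ∧ Primrec c ∧
    ∀ x, q x = ((a x : ℚ) - b x) / (c x + 1)

theorem RatPrimrec.ratOf {g : α → ℕ} (hg : Primrec g) : RatPrimrec fun x => ratOf (g x) :=
  ⟨_, _, _, Primrec.fst.comp (.comp .unpair (Primrec.fst.comp (.comp .unpair hg))),
    Primrec.snd.comp (.comp .unpair (Primrec.fst.comp (.comp .unpair hg))),
    Primrec.snd.comp (.comp .unpair hg), fun _ => rfl⟩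

theorem RatPrimrec.posRatOf {g : α → ℕ} (hg : Primrec g) : RatPrimrec fun x => posRatOf (g x) :=
  ⟨_, _, _, Primrec.succ.comp (Primrec.fst.comp (.comp .unpair hg)), .const 0,
    Primrec.snd.comp (.comp .unpair hg), fun x => by simp [SphereTTE.posRatOf]⟩

theorem RatPrimrec.natCast (n : ℕ) : RatPrimrec fun _ : α => (n : ℚ) :=
  ⟨_, _, _, .const n, .const 0, .const 0, fun x => by simp⟩

theorem RatPrimrec.add {q q' : α → ℚ} (h : RatPrimrec q) (h' : RatPrimrec q') :
    RatPrimrec fun x => q x + q' x := by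
  obtain ⟨a, b, c, ha, hb, hc, hq⟩ := h
  obtain ⟨a', b', c', ha', hb', hc', hq'⟩ := h'
  -- Denominators are stored minus one: the third witness is (c + 1)(c' + 1) - 1.
  refine ⟨fun x => a x * (c' x + 1) + a' x * (c x + 1), fun x => b x * (c' x + 1) + b' x * (c x + 1),
    fun x => c x * (c' x + 1) + c' x, ?_, ?_, ?_, fun x => ?_⟩
  · exact Primrec.nat_add.comp (Primrec.nat_mul.comp ha (Primrec.succ.comp hc'))
      (Primrec.nat_mul.comp ha' (Primrec.succ.comp hc))
  · exact Primrec.nat_add.comp (Primrec.nat_mul.comp hb (Primrec.succ.comp hc'))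
      (Primrec.nat_mul.comp hb' (Primrec.succ.comp hc))
  · exact Primrec.nat_add.comp (Primrec.nat_mul.comp hc (Primrec.succ.comp hc')) hc'
  · simp only [hq, hq']
    rw [div_add_div _ _ (by positivity) (by positivity)]
    push_cast
    congr 1 <;> ring

theorem RatPrimrec.neg {q : α → ℚ} (h : RatPrimrec q) : RatPrimrec fun x => -q x := by
  obtain ⟨a, b, c, ha, hb, hc, hq⟩ := h
  exact ⟨b, a, c, hb, ha, hc, fun x => by simp only [hq]; ring⟩

theorem RatPrimrec.sub {q q' : α → ℚ} (h : RatPrimrec q) (h' : RatPrimrec q') :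
    RatPrimrec fun x => q x - q' x := by
  simpa only [sub_eq_add_neg] using h.add h'.neg

theorem RatPrimrec.mul {q q' : α → ℚ} (h : RatPrimrec q) (h' : RatPrimrec q') :
    RatPrimrec fun x => q x * q' x := by
  obtain ⟨a, b, c, ha, hb, hc, hq⟩ := h
  obtain ⟨a', b', c', ha', hb', hc', hq'⟩ := h'
  refine ⟨fun x => a x * a' x + b x * b' x, fun x => a x * b' x + b x * a' x,
    fun x => c x * (c' x + 1) + c' x, ?_, ?_, ?_, fun x => ?_⟩
  · exact Primrec.nat_add.comp (Primrec.nat_mul.comp ha ha') (Primrec.nat_mul.comp hb hb')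
  · exact Primrec.nat_add.comp (Primrec.nat_mul.comp ha hb') (Primrec.nat_mul.comp hb ha')
  · exact Primrec.nat_add.comp (Primrec.nat_mul.comp hc (Primrec.succ.comp hc')) hc'
  · simp only [hq, hq']
    rw [div_mul_div_comm]
    push_cast
    congr 1 <;> ring

theorem RatPrimrec.lt {q q' : α → ℚ} (h : RatPrimrec q) (h' : RatPrimrec q') :
    PrimrecPred fun x => q x < q' x := by
  obtain ⟨a, b, c, ha, hb, hc, hq⟩ := h
  obtain ⟨a', b', c', ha', hb', hc', hq'⟩ := h'
  refine PrimrecPred.of_eq (Primrec.nat_lt.comp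
    (Primrec.nat_add.comp (Primrec.nat_mul.comp ha (Primrec.succ.comp hc'))
      (Primrec.nat_mul.comp hb' (Primrec.succ.comp hc)))
    (Primrec.nat_add.comp (Primrec.nat_mul.comp ha' (Primrec.succ.comp hc))
      (Primrec.nat_mul.comp hb (Primrec.succ.comp hc')))) fun x => ?_
  rw [hq, hq', div_lt_div_iff₀ (by positivity) (by positivity), ← Nat.cast_lt (α := ℚ)]
  push_cast
  constructor <;> intro h <;> linarith

end RatPrimrec

/-! ### Decidable relations between rational points and basic sets -/

/-- The abscissa of the lower left corner of the rectangle with code `k`. -/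
def cornerX (k : ℕ) : ℚ := ratOf (k / 2).unpair.1.unpair.1

/-- The ordinate of the lower left corner of the rectangle with code `k`. -/
def cornerY (k : ℕ) : ℚ := ratOf (k / 2).unpair.1.unpair.2

/-- The width of the rectangle with code `k`. -/
def width (k : ℕ) : ℚ := posRatOf (k / 2).unpair.2.unpair.1

/-- The height of the rectangle with code `k`. -/
def height (k : ℕ) : ℚ := posRatOf (k / 2).unpair.2.unpair.2

theorem basicSet_of_even {k : ℕ} (hk : k % 2 = 0) :
    basicSet k = rectangle (cornerX k) (cornerY k) (width k) (height k) := by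
  rw [basicSet, if_pos hk]
  rfl

theorem basicSet_of_odd {k : ℕ} (hk : k % 2 ≠ 0) :
    basicSet k = diskExterior (posRatOf (k / 2)) := by
  rw [basicSet, if_neg hk]

theorem coe_mem_rectangle {x y w h : ℚ} {z : ℂ} :
    (z : Sphere) ∈ rectangle x y w h ↔ (x : ℝ) < z.re ∧ z.re < (x : ℝ) + (w : ℝ) ∧
      (y : ℝ) < z.im ∧ z.im < (y : ℝ) + (h : ℝ) := by
  simp [rectangle]

theorem coe_mem_diskExterior {r : ℚ} {z : ℂ} :
    (z : Sphere) ∈ diskExterior r ↔ (r : ℝ) < ‖z‖ := by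
  simp [diskExterior]

theorem isOpen_basicSet (k : ℕ) : IsOpen (basicSet k) := by
  by_cases hk : k % 2 = 0
  · rw [basicSet_of_even hk, rectangle, OnePoint.isOpen_image_coe]
    refine (isOpen_lt continuous_const Complex.continuous_re).inter
      ((isOpen_lt Complex.continuous_re continuous_const).inter
        ((isOpen_lt continuous_const Complex.continuous_im).inter
          (isOpen_lt Complex.continuous_im continuous_const)))
  · rw [basicSet_of_odd hk, diskExterior, OnePoint.isOpen_compl_image_coe]
    exact ⟨Metric.isClosed_closedBall, isCompact_closedBall _ _⟩

/-- The rational point with code `m`. -/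
def pointOf (m : ℕ) : ℂ := ⟨(ratOf m.unpair.1 : ℝ), (ratOf m.unpair.2 : ℝ)⟩

/-- A test for the inclusion in the basic set with code `k` of the closed square with center
`x + iy` and side `2e`. -/
def SquareTest (x y e : ℚ) (k : ℕ) : Prop :=
  (k % 2 = 0 ∧ cornerX k < x - e ∧ x + e < cornerX k + width k ∧
    cornerY k < y - e ∧ y + e < cornerY k + height k) ∨
  (¬k % 2 = 0 ∧ (posRatOf (k / 2) + 2 * e) * (posRatOf (k / 2) + 2 * e) < x * x + y * y)

/-- For a disk exterior, a point of the square is within e + e of the center, so it suffices that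
the center has norm greater than r + 2e. -/
theorem SquareTest.coe_mem_basicSet {x y e : ℚ} {k : ℕ} (h : SquareTest x y e k) {z : ℂ}
    (hx : |z.re - x| ≤ e) (hy : |z.im - y| ≤ e) : (z : Sphere) ∈ basicSet k := by
  rw [abs_le] at hx hy
  rcases h with ⟨hk, h1, h2, h3, h4⟩ | ⟨hk, h1⟩
  · rw [basicSet_of_even hk, coe_mem_rectangle]
    rify at h1 h2 h3 h4
    exact ⟨by linarith, by linarith, by linarith, by linarith⟩
  · rw [basicSet_of_odd hk, coe_mem_diskExterior]
    have hr := posRatOf_pos (k / 2)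
    rify at h1 hr
    by_contra! hle
    have he : (0 : ℝ) ≤ e := by linarith
    have hw : ‖(⟨(x : ℝ), (y : ℝ)⟩ : ℂ)‖ ≤ posRatOf (k / 2) + 2 * e := by
      have h2 : ‖(⟨(x : ℝ), (y : ℝ)⟩ : ℂ) - z‖ ≤ |x - z.re| + |y - z.im| :=
        Complex.norm_le_abs_re_add_abs_im _
      have h3 : |(x : ℝ) - z.re| ≤ e := abs_le.2 ⟨by linarith, by linarith⟩
      have h4 : |(y : ℝ) - z.im| ≤ e := abs_le.2 ⟨by linarith, by linarith⟩
      have h5 : ‖(⟨(x : ℝ), (y : ℝ)⟩ : ℂ)‖ ≤ ‖(⟨(x : ℝ), (y : ℝ)⟩ : ℂ) - z‖ + ‖z‖ := by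
        simpa using norm_add_le ((⟨(x : ℝ), (y : ℝ)⟩ : ℂ) - z) z
      linarith
    have h6 := mul_self_le_mul_self (norm_nonneg _) hw
    rw [← sq, Complex.sq_norm, Complex.normSq_mk] at h6
    linarith

/-- The test consists of strict inequalities between continuous functions of (x, y, e), and it holds
at (Re ζ, Im ζ, 0). -/
theorem exists_squareTest_of_mem {ζ : ℂ} {k : ℕ} (h : (ζ : Sphere) ∈ basicSet k) :
    ∃ δ > 0, ∀ x y e : ℚ, |(x : ℝ) - ζ.re| < δ → |(y : ℝ) - ζ.im| < δ → |(e : ℝ)| < δ →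
      SquareTest x y e k := by
  let P : ℝ × ℝ × ℝ → Prop := fun v =>
    (k % 2 = 0 ∧ (cornerX k : ℝ) < v.1 - v.2.2 ∧ v.1 + v.2.2 < cornerX k + width k ∧
      (cornerY k : ℝ) < v.2.1 - v.2.2 ∧ v.2.1 + v.2.2 < cornerY k + height k) ∨
    (¬k % 2 = 0 ∧ (posRatOf (k / 2) + 2 * v.2.2) * (posRatOf (k / 2) + 2 * v.2.2) <
      v.1 * v.1 + v.2.1 * v.2.1)
  have hopen : IsOpen {v | P v} := by
    simp only [P, Set.ofPred_or, Set.ofPred_and]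
    refine (isOpen_const.inter (.inter ?_ (.inter ?_ (.inter ?_ ?_)))).union
      (isOpen_const.inter ?_)
    all_goals exact isOpen_lt (by fun_prop) (by fun_prop)
  have hmem : (ζ.re, ζ.im, (0 : ℝ)) ∈ {v | P v} := by
    by_cases hk : k % 2 = 0
    · rw [basicSet_of_even hk, coe_mem_rectangle] at h
      exact Or.inl ⟨hk, by simpa using h⟩
    · rw [basicSet_of_odd hk, coe_mem_diskExterior] at h
      refine Or.inr ⟨hk, ?_⟩
      have hr : (0 : ℝ) ≤ posRatOf (k / 2) := by exact_mod_cast (posRatOf_pos (k / 2)).le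
      have := mul_self_lt_mul_self hr h
      rw [← sq ‖ζ‖, Complex.sq_norm, Complex.normSq_apply] at this
      simpa using this
  obtain ⟨δ, hδ, hsub⟩ := Metric.isOpen_iff.1 hopen _ hmem
  refine ⟨δ, hδ, fun x y e hx hy he => ?_⟩
  have hP : P ((x : ℝ), (y : ℝ), (e : ℝ)) := hsub (by
    simp only [Metric.mem_ball, Prod.dist_eq, max_lt_iff, Real.dist_eq, sub_zero]
    exact ⟨hx, hy, he⟩)
  simp only [P] at hP
  exact_mod_cast hP

theorem squareTest_zero_iff {m k : ℕ} :
    SquareTest (ratOf m.unpair.1) (ratOf m.unpair.2) 0 k ↔ (pointOf m : Sphere) ∈ basicSet k := by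
  constructor
  · exact fun h => h.coe_mem_basicSet (by simp [pointOf]) (by simp [pointOf])
  · intro h
    obtain ⟨δ, hδ, H⟩ := exists_squareTest_of_mem h
    exact H _ _ _ (by simpa [pointOf] using hδ) (by simpa [pointOf] using hδ) (by simpa using hδ)

/-- A test for two rectangles that are separated by more than `K` times the size of the first. -/
def SeparationTest (K : ℕ) (j j' : ℕ) : Prop :=
  j % 2 = 0 ∧ j' % 2 = 0 ∧
    (cornerX j + width j + K * (width j + height j) < cornerX j' ∨
      cornerX j' + width j' + K * (width j + height j) < cornerX j ∨
      cornerY j + height j + K * (width j + height j) < cornerY j' ∨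
      cornerY j' + height j' + K * (width j + height j) < cornerY j)

/-- Width plus height bounds the distance of two points of the first rectangle, while the gap in a
single coordinate already exceeds K times that sum. -/
theorem SeparationTest.mul_norm_lt {K j j' : ℕ} (h : SeparationTest K j j') {ω w w' : ℂ}
    (hω : (ω : Sphere) ∈ basicSet j) (hw : (w : Sphere) ∈ basicSet j)
    (hw' : (w' : Sphere) ∈ basicSet j') : K * ‖w - ω‖ < ‖w' - w‖ := by
  obtain ⟨hj, hj', h⟩ := h
  rw [basicSet_of_even hj, coe_mem_rectangle] at hω hw
  rw [basicSet_of_even hj', coe_mem_rectangle] at hw'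
  obtain ⟨a1, a2, a3, a4⟩ := hω
  obtain ⟨b1, b2, b3, b4⟩ := hw
  obtain ⟨c1, c2, c3, c4⟩ := hw'
  have hsmall : ‖w - ω‖ ≤ (width j : ℝ) + height j := by
    refine (Complex.norm_le_abs_re_add_abs_im _).trans (add_le_add ?_ ?_)
    · rw [Complex.sub_re, abs_le]; exact ⟨by linarith, by linarith⟩
    · rw [Complex.sub_im, abs_le]; exact ⟨by linarith, by linarith⟩
  have hK : K * ‖w - ω‖ ≤ K * ((width j : ℝ) + height j) := by gcongr
  refine hK.trans_lt ?_
  have hre := abs_le.1 (Complex.abs_re_le_norm (w' - w))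
  have him := abs_le.1 (Complex.abs_im_le_norm (w' - w))
  rw [Complex.sub_re] at hre
  rw [Complex.sub_im] at him
  rify at h
  rcases h with h | h | h | h <;> linarith

theorem exists_small_rectangle (ω : ℂ) {η : ℝ} (hη : 0 < η) :
    ∃ j, j % 2 = 0 ∧ (ω : Sphere) ∈ basicSet j ∧ (width j : ℝ) < η ∧ (height j : ℝ) < η := by
  obtain ⟨w, hw0, hw⟩ := exists_rat_btwn hη
  obtain ⟨x, hx, hx'⟩ := exists_rat_btwn (show ω.re - w < ω.re by linarith)
  obtain ⟨y, hy, hy'⟩ := exists_rat_btwn (show ω.im - w < ω.im by linarith)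
  obtain ⟨a, ha⟩ := ratOf_surjective x
  obtain ⟨b, hb⟩ := ratOf_surjective y
  obtain ⟨c, hc⟩ := exists_posRatOf_eq (show 0 < w by exact_mod_cast hw0)
  have hj : 2 * Nat.pair (Nat.pair a b) (Nat.pair c c) % 2 = 0 := by omega
  refine ⟨2 * Nat.pair (Nat.pair a b) (Nat.pair c c), hj, ?_, ?_, ?_⟩
  · rw [basicSet_of_even hj, coe_mem_rectangle]
    simp only [cornerX, cornerY, width, height, Nat.mul_div_cancel_left _ zero_lt_two,
      Nat.unpair_pair, ha, hb, hc]
    exact ⟨by linarith, by linarith, by linarith, by linarith⟩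
  · simpa [width, hc] using hw
  · simpa [height, hc] using hw

theorem exists_separationTest (K : ℕ) {ω w : ℂ} (hne : ω ≠ w) :
    ∃ j j', (ω : Sphere) ∈ basicSet j ∧ (w : Sphere) ∈ basicSet j' ∧ SeparationTest K j j' := by
  have hd : 0 < |ω.re - w.re| + |ω.im - w.im| := by
    refine (norm_pos_iff.2 (sub_ne_zero.2 hne)).trans_le ?_
    simpa using Complex.norm_le_abs_re_add_abs_im (ω - w)
  set d := |ω.re - w.re| + |ω.im - w.im| with hd_def
  -- One coordinate differs by at least d/2 = 2Kη + 4η. Rectangles with sides below η consume less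
  -- than 2η of it, and K times width plus height is at most 2Kη.
  have hη : 0 < d / (4 * K + 8) := by positivity
  set η := d / (4 * K + 8) with hη_def
  have hdη : d = 2 * (2 * (K * η) + 4 * η) := by rw [hη_def]; field_simp; ring
  obtain ⟨j, hj, hω, hwj, hhj⟩ := exists_small_rectangle ω hη
  obtain ⟨j', hj', hw, hwj', hhj'⟩ := exists_small_rectangle w hη
  refine ⟨j, j', hω, hw, hj, hj', ?_⟩
  rw [basicSet_of_even hj, coe_mem_rectangle] at hω
  rw [basicSet_of_even hj', coe_mem_rectangle] at hw
  obtain ⟨a1, a2, a3, a4⟩ := hω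
  obtain ⟨b1, b2, b3, b4⟩ := hw
  have hK : (K : ℝ) * (width j + height j) ≤ 2 * (K * η) := by
    calc (K : ℝ) * (width j + height j) ≤ K * (η + η) := by gcongr
      _ = 2 * (K * η) := by ring
  rify
  rcases le_total |ω.re - w.re| |ω.im - w.im| with hle | hle
  · right; right
    rcases le_total ω.im w.im with h | h
    · left
      rw [abs_of_nonpos (by linarith : ω.im - w.im ≤ 0)] at hle hd_def
      linarith
    · right
      rw [abs_of_nonneg (by linarith : 0 ≤ ω.im - w.im)] at hle hd_def
      linarith
  · rcases le_total ω.re w.re with h | h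
    · left
      rw [abs_of_nonpos (by linarith : ω.re - w.re ≤ 0)] at hle hd_def
      linarith
    · right; left
      rw [abs_of_nonneg (by linarith : 0 ≤ ω.re - w.re)] at hle hd_def
      linarith

theorem exists_pointOf_mem {U : Set ℂ} (hU : IsOpen U) (hne : U.Nonempty) :
    ∃ m, pointOf m ∈ U := by
  obtain ⟨z, hz⟩ := hne
  obtain ⟨ε, hε, hsub⟩ := Metric.isOpen_iff.1 hU z hz
  obtain ⟨x, hx, hx'⟩ := exists_rat_btwn (show z.re < z.re + ε / 2 by linarith)
  obtain ⟨y, hy, hy'⟩ := exists_rat_btwn (show z.im < z.im + ε / 2 by linarith)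
  obtain ⟨a, ha⟩ := ratOf_surjective x
  obtain ⟨b, hb⟩ := ratOf_surjective y
  refine ⟨Nat.pair a b, hsub ?_⟩
  rw [mem_ball_iff_norm]
  refine (Complex.norm_le_abs_re_add_abs_im _).trans_lt ?_
  simp only [pointOf, Nat.unpair_pair, ha, hb, Complex.sub_re, Complex.sub_im]
  rw [abs_of_pos (by linarith), abs_of_pos (by linarith)]
  linarith

section Primrec

variable {α : Type*} [Primcodable α]

theorem primrec_div_two {k : α → ℕ} (hk : Primrec k) : Primrec fun a => k a / 2 :=
  Primrec.nat_div.comp hk (.const 2)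

theorem primrec_unpair_fst {k : α → ℕ} (hk : Primrec k) : Primrec fun a => (k a).unpair.1 :=
  Primrec.fst.comp (Primrec.unpair.comp hk)

theorem primrec_unpair_snd {k : α → ℕ} (hk : Primrec k) : Primrec fun a => (k a).unpair.2 :=
  Primrec.snd.comp (Primrec.unpair.comp hk)

theorem ratPrimrec_cornerX {k : α → ℕ} (hk : Primrec k) : RatPrimrec fun a => cornerX (k a) :=
  .ratOf (primrec_unpair_fst (primrec_unpair_fst (primrec_div_two hk)))

theorem ratPrimrec_cornerY {k : α → ℕ} (hk : Primrec k) : RatPrimrec fun a => cornerY (k a) :=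
  .ratOf (primrec_unpair_snd (primrec_unpair_fst (primrec_div_two hk)))

theorem ratPrimrec_width {k : α → ℕ} (hk : Primrec k) : RatPrimrec fun a => width (k a) :=
  .posRatOf (primrec_unpair_fst (primrec_unpair_snd (primrec_div_two hk)))

theorem ratPrimrec_height {k : α → ℕ} (hk : Primrec k) : RatPrimrec fun a => height (k a) :=
  .posRatOf (primrec_unpair_snd (primrec_unpair_snd (primrec_div_two hk)))

theorem primrecPred_even {k : α → ℕ} (hk : Primrec k) : PrimrecPred fun a => k a % 2 = 0 :=
  Primrec.eq.comp (Primrec.nat_mod.comp hk (.const 2)) (.const 0)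

theorem primrecPred_squareTest {x y e : α → ℚ} {k : α → ℕ} (hx : RatPrimrec x)
    (hy : RatPrimrec y) (he : RatPrimrec e) (hk : Primrec k) :
    PrimrecPred fun a => SquareTest (x a) (y a) (e a) (k a) := by
  have hr := (RatPrimrec.posRatOf (primrec_div_two hk)).add ((RatPrimrec.natCast 2).mul he)
  exact (PrimrecPred.and (primrecPred_even hk)
    (PrimrecPred.and ((ratPrimrec_cornerX hk).lt (hx.sub he))
      (PrimrecPred.and ((hx.add he).lt ((ratPrimrec_cornerX hk).add (ratPrimrec_width hk)))
        (PrimrecPred.and ((ratPrimrec_cornerY hk).lt (hy.sub he))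
          ((hy.add he).lt ((ratPrimrec_cornerY hk).add (ratPrimrec_height hk))))))).or
    ((primrecPred_even hk).not.and ((hr.mul hr).lt ((hx.mul hx).add (hy.mul hy))))

theorem primrecPred_separationTest (K : ℕ) {j j' : α → ℕ} (hj : Primrec j) (hj' : Primrec j') :
    PrimrecPred fun a => SeparationTest K (j a) (j' a) := by
  have hs := (RatPrimrec.natCast K).mul ((ratPrimrec_width hj).add (ratPrimrec_height hj))
  exact PrimrecPred.and (primrecPred_even hj) (PrimrecPred.and (primrecPred_even hj')
    (PrimrecPred.or ((((ratPrimrec_cornerX hj).add (ratPrimrec_width hj)).add hs).lt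
        (ratPrimrec_cornerX hj'))
      (PrimrecPred.or ((((ratPrimrec_cornerX hj').add (ratPrimrec_width hj')).add hs).lt
          (ratPrimrec_cornerX hj))
        (PrimrecPred.or ((((ratPrimrec_cornerY hj).add (ratPrimrec_height hj)).add hs).lt
            (ratPrimrec_cornerY hj'))
          ((((ratPrimrec_cornerY hj').add (ratPrimrec_height hj')).add hs).lt
            (ratPrimrec_cornerY hj))))))

end Primrec

end SphereTTE

/-! ### Conformal maps between sphere domains: the point ∞, openness, boundary behavior -/

namespace SphereTTE

open Metric Set Filter Topology

theorem tendsto_coe_cobounded_nhds_infty :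
    Tendsto (fun z : ℂ => (z : Sphere)) (Bornology.cobounded ℂ) (𝓝 ∞) := by
  rw [Metric.cobounded_eq_cocompact, ← coclosedCompact_eq_cocompact]
  exact OnePoint.tendsto_coe_infty

/-- Since g(z) - z tends to 0, |g(z)| tends to infinity with |z|; by continuity the limit ∞ is the
value at ∞. -/
theorem IsNormalizedAtInfinity.map_infty {f : Sphere → Sphere} (h : IsNormalizedAtInfinity f)
    (hf : ContinuousAt f ∞) : f ∞ = ∞ := by
  obtain ⟨g, hg, hO⟩ := h
  have h0 : Tendsto (fun z : ℂ => g z - z) (Bornology.cobounded ℂ) (𝓝 0) :=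
    hO.trans_tendsto tendsto_inv₀_cobounded
  have hgt : Tendsto g (Bornology.cobounded ℂ) (Bornology.cobounded ℂ) := by
    rw [← tendsto_norm_atTop_iff_cobounded]
    have h1 : Tendsto (fun z : ℂ => ‖z‖ - ‖g z - z‖) (Bornology.cobounded ℂ) atTop :=
      tendsto_norm_cobounded_atTop.atTop_add h0.norm.neg |>.congr fun z => by ring
    refine tendsto_atTop_mono (fun z => ?_) h1
    have := norm_sub_le (g z) (g z - z)
    rw [sub_sub_cancel] at this
    linarith
  have h1 : Tendsto (fun z : ℂ => f z) (Bornology.cobounded ℂ) (𝓝 (f ∞)) :=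
    Tendsto.comp hf tendsto_coe_cobounded_nhds_infty
  have h2 : Tendsto (fun z : ℂ => f z) (Bornology.cobounded ℂ) (𝓝 ∞) :=
    (tendsto_coe_cobounded_nhds_infty.comp hgt).congr' (hg.mono fun z hz => hz.symm)
  exact tendsto_nhds_unique h1 h2

/-- The map of the plane induced by a map of the sphere, with junk value `0` for `∞`. -/
def planeMap (f : Sphere → Sphere) (z : ℂ) : ℂ :=
  (f z).elim 0 fun w => w

theorem planeMap_of_eq {f : Sphere → Sphere} {z w : ℂ} (h : f z = w) : planeMap f z = w := by
  simp [planeMap, h]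

section Conformal

variable {f : Sphere → Sphere} {D C : Set Sphere}

theorem IsConformalMap.map_coe (hf : IsConformalMap f D C) (hD : ∞ ∈ D) (hinf : f ∞ = ∞) {z : ℂ}
    (hz : (z : Sphere) ∈ D) : f z = planeMap f z := by
  have hne : f z ≠ ∞ := fun h => OnePoint.coe_ne_infty z (hf.2.injOn hz hD (h.trans hinf.symm))
  obtain ⟨w, hw⟩ := OnePoint.ne_infty_iff_exists.1 hne
  rw [planeMap_of_eq hw.symm, hw]

theorem IsConformalMap.analyticAt_planeMap (hf : IsConformalMap f D C) (hD : ∞ ∈ D)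
    (hinf : f ∞ = ∞) {a : ℂ} (ha : (a : Sphere) ∈ D) : AnalyticAt ℂ (planeMap f) a := by
  have h := (hf.1 a ha).2
  rw [hf.map_coe hD hinf ha] at h
  have h1 : AnalyticAt ℂ (fun w => planeMap f (a + w)) 0 := h
  have h2 : AnalyticAt ℂ (fun z : ℂ => z - a) a := by fun_prop
  have h3 := h1.comp_of_eq h2 (sub_self a)
  refine h3.congr (.of_forall fun z => ?_)
  simp

theorem IsConformalMap.injOn_planeMap (hf : IsConformalMap f D C) (hD : ∞ ∈ D)
    (hinf : f ∞ = ∞) {U : Set ℂ} (hU : ∀ z ∈ U, (z : Sphere) ∈ D) : InjOn (planeMap f) U := by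
  intro z hz w hw h
  have := hf.2.injOn (hU z hz) (hU w hw)
    (by rw [hf.map_coe hD hinf (hU z hz), hf.map_coe hD hinf (hU w hw), h])
  exact OnePoint.coe_injective this

/-- Distances to an omitted value grow by at most a constant factor between the center of a disk in
the domain and a point halfway to its boundary. -/
theorem IsConformalMap.norm_sub_le (hf : IsConformalMap f D C) (hD : ∞ ∈ D) (hinf : f ∞ = ∞)
    {c z ω : ℂ} {R : ℝ} (hR : 0 < R) (hball : ∀ u ∈ ball c R, (u : Sphere) ∈ D)
    (hω : (ω : Sphere) ∉ C) (hz : dist z c ≤ R / 2) :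
    ‖planeMap f z - planeMap f c‖ ≤ (Real.exp 16 + 1) * ‖planeMap f c - ω‖ := by
  have hd : DifferentiableOn ℂ (fun u => planeMap f u - ω) (ball c R) := fun u hu =>
    ((hf.analyticAt_planeMap hD hinf (hball u hu)).differentiableAt.sub_const
      ω).differentiableWithinAt
  have hne : ∀ u ∈ ball c R, planeMap f u - ω ≠ 0 := by
    intro u hu h0
    refine hω ?_
    rw [← sub_eq_zero.1 h0, ← hf.map_coe hD hinf (hball u hu)]
    exact hf.2.mapsTo (hball u hu)
  have hinj : InjOn (fun u => planeMap f u - ω) (ball c R) := fun u hu v hv h =>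
    hf.injOn_planeMap hD hinf hball hu hv (sub_left_injective h)
  have h1 := norm_le_exp_mul_of_injOn hR hd hne hinj hz
  have h2 : ‖planeMap f z - planeMap f c‖ ≤ ‖planeMap f z - ω‖ + ‖planeMap f c - ω‖ := by
    have := _root_.norm_sub_le (planeMap f z - ω) (planeMap f c - ω)
    rwa [sub_sub_sub_cancel_right] at this
  linarith

/-- The open mapping theorem; its alternative, local constancy, contradicts injectivity. -/
theorem IsConformalMap.image_mem_nhds_coe (hf : IsConformalMap f D C) (hDo : IsOpen D)
    (hD : ∞ ∈ D) (hinf : f ∞ = ∞) {a : ℂ} (ha : (a : Sphere) ∈ D) {V : Set Sphere}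
    (hV : V ∈ 𝓝 (a : Sphere)) : f '' V ∈ 𝓝 (f a) := by
  have hU : (fun z : ℂ => (z : Sphere)) ⁻¹' (V ∩ D) ∈ 𝓝 a :=
    OnePoint.continuous_coe.continuousAt.preimage_mem_nhds (inter_mem hV (hDo.mem_nhds ha))
  rcases (hf.analyticAt_planeMap hD hinf ha).eventually_constant_or_nhds_le_map_nhds with h | h
  · obtain ⟨z, ⟨h1, h2⟩, h3⟩ := Filter.nonempty_of_mem
      (inter_mem (mem_nhdsWithin_of_mem_nhds (inter_mem h hU))
        (self_mem_nhdsWithin : {a}ᶜ ∈ 𝓝[≠] a))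
    refine absurd ?_ h3
    exact hf.injOn_planeMap hD hinf (U := (fun z : ℂ => (z : Sphere)) ⁻¹' (V ∩ D))
      (fun z hz => hz.2) h2 (mem_of_mem_nhds hU) h1
  · rw [hf.map_coe hD hinf ha, OnePoint.nhds_coe_eq]
    have h1 := h (image_mem_map hU)
    refine mem_map.2 (mem_of_superset h1 ?_)
    rintro _ ⟨z, hz, rfl⟩
    exact ⟨z, hz.1, hf.map_coe hD hinf hz.2⟩

theorem continuousAt_param_infty : ContinuousAt (param ∞) 0 := by
  have h0 : param ∞ 0 = ∞ := by simp [param]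
  rw [ContinuousAt, h0, ← nhdsNE_sup_pure, tendsto_sup]
  constructor
  · refine (tendsto_coe_cobounded_nhds_infty.comp tendsto_inv₀_nhdsNE_zero).congr' ?_
    filter_upwards [self_mem_nhdsWithin] with w hw
    have : w ≠ 0 := hw
    simp [param, this]
  · rw [tendsto_pure_left]
    intro s hs
    rw [h0]
    exact mem_of_mem_nhds hs

theorem IsConformalMap.image_mem_nhds_infty (hf : IsConformalMap f D C) (hDo : IsOpen D)
    (hD : ∞ ∈ D) (hinf : f ∞ = ∞) {V : Set Sphere} (hV : V ∈ 𝓝 (∞ : Sphere)) :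
    f '' V ∈ 𝓝 (∞ : Sphere) := by
  set G : ℂ → ℂ := fun w => coord ∞ (f (param ∞ w)) with hG
  have hGan : AnalyticAt ℂ G 0 := by
    have := (hf.1 ∞ hD).2
    rwa [hinf] at this
  have hp0 : param ∞ 0 = ∞ := by simp [param]
  have hG0 : G 0 = 0 := by simp [hG, hp0, hinf, coord]
  have hW : param ∞ ⁻¹' (V ∩ D) ∈ 𝓝 (0 : ℂ) := by
    refine continuousAt_param_infty.preimage_mem_nhds ?_
    rw [hp0]
    exact inter_mem hV (hDo.mem_nhds hD)
  -- In the coordinate 1/z the junk value 0⁻¹ = 0 makes the point 0 look like ∞. Near ∞ the map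
  -- avoids 0, so a vanishing coordinate cannot come from there.
  have hne0 : ∀ᶠ w in 𝓝 (0 : ℂ), f (param ∞ w) ≠ ((0 : ℂ) : Sphere) := by
    have h1 : ContinuousAt (fun w => f (param ∞ w)) 0 :=
      ContinuousAt.comp_of_eq (hf.1 ∞ hD).1 continuousAt_param_infty hp0
    refine h1.eventually_ne ?_
    rw [hp0, hinf]
    exact OnePoint.infty_ne_coe _
  rcases hGan.eventually_constant_or_nhds_le_map_nhds with h | h
  · obtain ⟨w, ⟨⟨h1, h2⟩, h3⟩, h4⟩ := Filter.nonempty_of_mem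
      (inter_mem (mem_nhdsWithin_of_mem_nhds (inter_mem (inter_mem h hW) hne0))
        (self_mem_nhdsWithin : {(0 : ℂ)}ᶜ ∈ 𝓝[≠] 0))
    have hw : w ≠ 0 := h4
    have hpw : param ∞ w = ((w⁻¹ : ℂ) : Sphere) := by simp [param, hw]
    have h1' : coord ∞ (f (param ∞ w)) = 0 := h1.trans hG0
    have h2' : ((w⁻¹ : ℂ) : Sphere) ∈ D := hpw ▸ h2.2
    have h3' : f (param ∞ w) ≠ ((0 : ℂ) : Sphere) := h3
    rw [hpw, hf.map_coe hD hinf h2'] at h1' h3'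
    have h5 : (planeMap f w⁻¹)⁻¹ = 0 := h1'
    rw [inv_eq_zero] at h5
    exact absurd (by rw [h5]) h3'
  · rw [hG0] at h
    have h1 : G '' (param ∞ ⁻¹' (V ∩ D)) ∈ 𝓝 (0 : ℂ) := h (image_mem_map hW)
    rw [OnePoint.nhds_infty_eq, mem_sup, mem_map, mem_pure, coclosedCompact_eq_cocompact,
      ← Metric.cobounded_eq_cocompact]
    refine ⟨?_, ∞, mem_of_mem_nhds hV, hinf⟩
    filter_upwards [tendsto_inv₀_cobounded h1, Bornology.eventually_ne_cobounded (0 : ℂ)] with b hb hb0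
    obtain ⟨w, hw, he⟩ := hb
    refine ⟨param ∞ w, hw.1, ?_⟩
    have he' : coord ∞ (f (param ∞ w)) = b⁻¹ := he
    have hfin : f (param ∞ w) ≠ ∞ := by
      intro h0
      rw [h0] at he'
      exact inv_ne_zero hb0 he'.symm
    obtain ⟨b', hb'⟩ := OnePoint.ne_infty_iff_exists.1 hfin
    rw [← hb'] at he' ⊢
    have h6 : b'⁻¹ = b⁻¹ := he'
    rw [inv_injective h6]

theorem IsConformalMap.image_mem_nhds (hf : IsConformalMap f D C) (hDo : IsOpen D)
    (hD : ∞ ∈ D) (hinf : f ∞ = ∞) {p : Sphere} (hp : p ∈ D) {V : Set Sphere}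
    (hV : V ∈ 𝓝 p) : f '' V ∈ 𝓝 (f p) := by
  induction p using OnePoint.rec with
  | infty => rw [hinf]; exact hf.image_mem_nhds_infty hDo hD hinf hV
  | coe a => exact hf.image_mem_nhds_coe hDo hD hinf hp hV

/-- Near a boundary point of `D` there are points of `D` with images near some boundary point
of `C`. -/
theorem IsConformalMap.exists_mapClusterPt (hf : IsConformalMap f D C) (hDo : IsOpen D)
    (hCo : IsOpen C) (hD : ∞ ∈ D) (hinf : f ∞ = ∞) {ζ : Sphere} (hζ : ζ ∈ frontier D) :
    ∃ ω : ℂ, (ω : Sphere) ∈ frontier C ∧ MapClusterPt (ω : Sphere) (𝓝[D] ζ) f := by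
  rw [hDo.frontier_eq] at hζ
  have : (𝓝[D] ζ).NeBot := mem_closure_iff_nhdsWithin_neBot.1 hζ.1
  obtain ⟨w, -, hw⟩ := isCompact_univ (X := Sphere) (f := map f (𝓝[D] ζ)) (by simp)
  -- If w = f(p) with p in `D`, then a neighborhood of p, disjoint from one of ζ, is mapped onto a
  -- neighborhood of w. Points near ζ with images near w would then violate injectivity.
  have hwC : w ∉ C := by
    intro hwC
    obtain ⟨p, hp, rfl⟩ := hf.2.surjOn hwC
    have hne : p ≠ ζ := fun h => hζ.2 (h ▸ hp)
    obtain ⟨V, V', hVo, hVo', hpV, hζV, hdisj⟩ := t2_separation hne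
    have h1 := hf.image_mem_nhds hDo hD hinf hp ((hVo.inter hDo).mem_nhds ⟨hpV, hp⟩)
    have h2 : ∃ᶠ z in 𝓝[D] ζ, f z ∈ f '' (V ∩ D) :=
      mapClusterPt_iff_frequently.1 hw _ h1
    have h3 : ∀ᶠ z in 𝓝[D] ζ, z ∈ V' ∧ z ∈ D :=
      inter_mem (mem_nhdsWithin_of_mem_nhds (hVo'.mem_nhds hζV)) self_mem_nhdsWithin
    obtain ⟨z, ⟨u, hu, he⟩, hz⟩ := (h2.and_eventually h3).exists
    have : u = z := hf.2.injOn hu.2 hz.2 he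
    subst this
    exact disjoint_left.1 hdisj hu.1 hz.1
  have hwcl : w ∈ closure C := by
    refine mem_closure_iff_clusterPt.2 (hw.mono ?_)
    rw [le_principal_iff, mem_map]
    exact mem_of_superset self_mem_nhdsWithin hf.2.mapsTo
  have hwne : w ≠ ∞ := by
    rintro rfl
    exact hwC (hinf ▸ hf.2.mapsTo hD)
  obtain ⟨ω, rfl⟩ := OnePoint.ne_infty_iff_exists.1 hwne
  exact ⟨ω, by rw [hCo.frontier_eq]; exact ⟨hwcl, hwC⟩, hw⟩

/-- The points with rational coordinates witness the approach of the boundary. -/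
theorem IsConformalMap.exists_pointOf_of_mapClusterPt (hf : IsConformalMap f D C)
    (hDo : IsOpen D) {ζ : ℂ} {ω : Sphere} (h : MapClusterPt ω (𝓝[D] (ζ : Sphere)) f)
    {U : Set ℂ} (hU : IsOpen U) (hζ : ζ ∈ U) {W : Set Sphere} (hW : IsOpen W) (hω : ω ∈ W) :
    ∃ m, pointOf m ∈ U ∧ (pointOf m : Sphere) ∈ D ∧ f (pointOf m) ∈ W := by
  have hcont : ContinuousOn f D := fun p hp => (hf.1 p hp).1.continuousWithinAt
  have hopen : IsOpen (D ∩ f ⁻¹' W) := hcont.isOpen_inter_preimage hDo hW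
  have hne : (U ∩ (fun z : ℂ => (z : Sphere)) ⁻¹' (D ∩ f ⁻¹' W)).Nonempty := by
    have h1 : ∃ᶠ z in 𝓝[D] (ζ : Sphere), f z ∈ W :=
      mapClusterPt_iff_frequently.1 h _ (hW.mem_nhds hω)
    have h2 : ∀ᶠ z in 𝓝[D] (ζ : Sphere), z ∈ (fun z : ℂ => (z : Sphere)) '' U ∧ z ∈ D :=
      inter_mem (mem_nhdsWithin_of_mem_nhds ((OnePoint.isOpen_image_coe.2 hU).mem_nhds
        ⟨ζ, hζ, rfl⟩)) self_mem_nhdsWithin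
    obtain ⟨_, hz, ⟨u, hu, rfl⟩, hz'⟩ := (h1.and_eventually h2).exists
    exact ⟨u, hu, hz', hz⟩
  obtain ⟨m, hm⟩ := exists_pointOf_mem
    (hU.inter (hopen.preimage OnePoint.continuous_coe)) hne
  exact ⟨m, hm.1, hm.2.1, hm.2.2⟩

end Conformal

/-- Otherwise `D` and the complement of its closure would separate the connected disk. -/
theorem exists_mem_ball_frontier {D : Set Sphere} (hDo : IsOpen D) {c z : ℂ} {R : ℝ}
    (hc : (c : Sphere) ∈ D) (hz : z ∈ ball c R) (hzD : (z : Sphere) ∉ D) :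
    ∃ u ∈ ball c R, (u : Sphere) ∈ frontier D := by
  by_contra! h
  have hR : 0 < R := dist_nonneg.trans_lt hz
  have hconn : IsPreconnected ((fun z : ℂ => (z : Sphere)) '' ball c R) :=
    (convex_ball c R).isPreconnected.image _ OnePoint.continuous_coe.continuousOn
  have hsub := hconn.subset_left_of_subset_union hDo (isClosed_closure (s := D)).isOpen_compl
    (disjoint_compl_right.mono_left subset_closure) (by
      rintro _ ⟨u, hu, rfl⟩
      by_cases huD : (u : Sphere) ∈ D
      · exact Or.inl huD
      · exact Or.inr fun hcl => h u hu (by rw [hDo.frontier_eq]; exact ⟨hcl, huD⟩))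
    ⟨c, mem_image_of_mem _ (mem_ball_self hR), hc⟩
  exact hzD (hsub (mem_image_of_mem _ hz))

end SphereTTE

namespace SphereTTE

open Metric Set Filter Topology

/-! ### Names of rational points -/

open Classical in
/-- The standard name of the rational point with code `m`. -/
noncomputable def pointName (m k : ℕ) : ℕ :=
  if SquareTest (ratOf m.unpair.1) (ratOf m.unpair.2) 0 k then k + 1 else 0

theorem namesPoint_pointName (m : ℕ) : NamesPoint (pointName m) (pointOf m) := by
  intro k
  rw [mem_ofPred_eq, ← squareTest_zero_iff]
  constructor
  · exact fun h => ⟨k, by rw [pointName, if_pos h]⟩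
  · rintro ⟨i, hi⟩
    rw [pointName] at hi
    split_ifs at hi with h
    rwa [Nat.succ.inj hi] at h

/-- What is known about the input tape of the machine that computes `f`, started on the standard
name of the rational point with code `s.1`, when the initial segment `s.2` of the whole input is
known. -/
noncomputable def tapeInfo (s : ℕ × List ℕ) (n : ℕ) : Option ℕ :=
  -- An odd cell n carries the oracle bit n / 2. It is entry n / 2 + 1 of the name q, whose entry 0
  -- is the program, and q occupies the cells 4i + 1 of the whole input.
  if n % 2 = 0 then some (pointName s.1 (n / 2)) else s.2[4 * (n / 2 + 1) + 1]?

open Classical in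
theorem primrec₂_tapeInfo : Primrec₂ tapeInfo := by
  have hn : Primrec fun a : (ℕ × List ℕ) × ℕ => a.2 / 2 := primrec_div_two .snd
  have hm : Primrec fun a : (ℕ × List ℕ) × ℕ => a.1.1 := Primrec.fst.comp .fst
  refine .ite (primrecPred_even .snd) (Primrec.option_some.comp ?_) ?_
  · refine .ite (primrecPred_squareTest (.ratOf (primrec_unpair_fst hm))
      (.ratOf (primrec_unpair_snd hm)) ?_ hn) (Primrec.succ.comp hn) (.const 0)
    simpa using RatPrimrec.natCast 0
  · exact Primrec.list_getElem?.comp (Primrec.snd.comp .fst) (Primrec.succ.comp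
      (Primrec.nat_mul.comp (.const 4) (Primrec.succ.comp hn)))

/-! ### The input tape -/

theorem join_two_mul (p q : ℕ → ℕ) (i : ℕ) : join p q (2 * i) = p i := by
  simp [join]

theorem join_two_mul_add_one (p q : ℕ → ℕ) (i : ℕ) : join p q (2 * i + 1) = q i := by
  have h1 : (2 * i + 1) % 2 ≠ 0 := by omega
  have h2 : (2 * i + 1) / 2 = i := by omega
  rw [join, if_neg h1, h2]

section Tape

variable (p n q r : ℕ → ℕ) (i : ℕ)

theorem join_join_four_mul : join (join p n) (join q r) (4 * i) = p i := by
  rw [show 4 * i = 2 * (2 * i) by ring, join_two_mul, join_two_mul]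

theorem join_join_four_mul_add_one : join (join p n) (join q r) (4 * i + 1) = q i := by
  rw [show 4 * i + 1 = 2 * (2 * i) + 1 by ring, join_two_mul_add_one, join_two_mul]

theorem join_join_four_mul_add_three : join (join p n) (join q r) (4 * i + 3) = r i := by
  rw [show 4 * i + 3 = 2 * (2 * i + 1) + 1 by ring, join_two_mul_add_one, join_two_mul_add_one]

end Tape

theorem eq_of_getElem?_map_range {O : ℕ → ℕ} {N i v : ℕ}
    (h : ((List.range N).map O)[i]? = some v) : O i = v := by
  rw [List.getElem?_map, Option.map_eq_some_iff] at h
  obtain ⟨a, ha, rfl⟩ := h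
  obtain ⟨_, rfl⟩ := List.getElem?_eq_some_iff.1 ha
  simp

theorem eventually_getElem?_map_range (O : ℕ → ℕ) (i : ℕ) :
    ∀ᶠ N in atTop, ((List.range N).map O)[i]? = some (O i) := by
  filter_upwards [eventually_gt_atTop i] with N hN
  simp [hN]

theorem eq_of_tapeInfo_eq_some {p n q r : ℕ → ℕ} {X : Set ℕ} (hq : ∀ k, q (k + 1) = charSeq X k)
    {m N i v : ℕ}
    (h : tapeInfo (m, (List.range N).map (join (join p n) (join q r))) i = some v) :
    v = join (pointName m) (charSeq X) i := by
  rw [tapeInfo] at h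
  rw [join]
  split_ifs at h ⊢ with hi
  · exact (Option.some.inj h).symm
  · rw [← eq_of_getElem?_map_range h, join_join_four_mul_add_one, hq]

theorem eventually_tapeInfo {p n q r : ℕ → ℕ} {X : Set ℕ} (hq : ∀ k, q (k + 1) = charSeq X k)
    (m i : ℕ) :
    ∀ᶠ N in atTop, tapeInfo (m, (List.range N).map (join (join p n) (join q r))) i =
      some (join (pointName m) (charSeq X) i) := by
  filter_upwards [eventually_getElem?_map_range (join (join p n) (join q r))
    (4 * (i / 2 + 1) + 1)] with N hN
  rw [tapeInfo, join]
  split_ifs with hi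
  · rfl
  · rw [hN, join_join_four_mul_add_one, hq]

/-! ### Certificates -/

/-- The bounded simulation of the machine that computes `f` on a rational point. -/
noncomputable def simulate : ℕ × List ℕ → ℕ → ℕ → ℕ → Option ℕ :=
  (OracleCode.exists_simulation primrec₂_tapeInfo).choose

theorem primrec_simulate : Primrec fun a : (ℕ × List ℕ) × ℕ × ℕ × ℕ =>
    simulate a.1 a.2.1 a.2.2.1 a.2.2.2 :=
  (OracleCode.exists_simulation primrec₂_tapeInfo).choose_spec.1

section Simulate

variable {p n q r : ℕ → ℕ} {X : Set ℕ} {c : OracleCode} {D : Set Sphere} {f : Sphere → Sphere}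

theorem mem_basicSet_of_simulate (hq : ∀ k, q (k + 1) = charSeq X k) (hc : ComputesFun c X D f)
    {m N t u j : ℕ} (hm : (pointOf m : Sphere) ∈ D)
    (h : simulate (m, (List.range N).map (join (join p n) (join q r))) t c.encode u =
      some (j + 1)) : f (pointOf m) ∈ basicSet j := by
  obtain ⟨s, hs, hs'⟩ := hc _ hm _ (namesPoint_pointName m)
  have h1 := (OracleCode.exists_simulation primrec₂_tapeInfo).choose_spec.2.1 _ _ c
    (fun i v hv => eq_of_tapeInfo_eq_some hq hv) t u _ h
  rw [hs u, Part.mem_some_iff] at h1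
  exact (hs' j).2 ⟨u, h1.symm⟩

/-- The output cell `u` that lists `j` is the same for all prefix lengths; only the prefix and the
time bound have to be large enough. -/
theorem exists_simulate_of_mem_basicSet (hq : ∀ k, q (k + 1) = charSeq X k)
    (hc : ComputesFun c X D f) {m j : ℕ} (hm : (pointOf m : Sphere) ∈ D)
    (hj : f (pointOf m) ∈ basicSet j) :
    ∃ u, ∀ᶠ N in atTop, ∃ t,
      simulate (m, (List.range N).map (join (join p n) (join q r))) t c.encode u =
        some (j + 1) := by
  obtain ⟨s, hs, hs'⟩ := hc _ hm _ (namesPoint_pointName m)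
  obtain ⟨u, hu⟩ := (hs' j).1 hj
  refine ⟨u, (OracleCode.exists_simulation primrec₂_tapeInfo).choose_spec.2.2
    (fun N => (m, (List.range N).map (join (join p n) (join q r)))) _ c
    (fun i => eventually_tapeInfo hq m i) u (j + 1) ?_⟩
  rw [hs u, hu]
  exact Part.mem_some _

end Simulate

/-- A bound for the distortion constant of `IsConformalMap.norm_sub_le`. -/
noncomputable def distortionBound : ℕ := ⌈Real.exp 16 + 1⌉₊

/-- The numbers `m, m', d, e, a, i, j, i', j', t, u, t', u'` certify, by the initial segment `L` of the
input tape, that the basic set with code `k` meets the boundary of `D`: it contains a square around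
the rational point `m` of `D`, and the rational point `m'` is so near to `m` that the distance of
their images would be smaller, compared with the distance to the boundary of `C`, if the square were
contained in `D`. -/
def Certifies (L : List ℕ) (k m m' d e a i j i' j' t u t' u' : ℕ) : Prop :=
  L[1]? = some d ∧ L[4 * i]? = some (a + 1) ∧
  SquareTest (ratOf m.unpair.1) (ratOf m.unpair.2) 0 a ∧
  L[4 * i' + 3]? = some (j + 1) ∧ SeparationTest distortionBound j j' ∧
  SquareTest (ratOf m.unpair.1) (ratOf m.unpair.2) (4 * posRatOf e) k ∧
  ratOf m.unpair.1 - ratOf m'.unpair.1 < posRatOf e ∧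
  ratOf m'.unpair.1 - ratOf m.unpair.1 < posRatOf e ∧
  ratOf m.unpair.2 - ratOf m'.unpair.2 < posRatOf e ∧
  ratOf m'.unpair.2 - ratOf m.unpair.2 < posRatOf e ∧
  simulate (m, L) t d u = some (j + 1) ∧
  simulate (m', L) t' d u' = some (j' + 1)

/-- A closed disk is compact, so its image is closed in the sphere and contains the closure of any
small rectangle inside it. -/
theorem exists_basicSet_closure_subset {U : Set Sphere} (hU : IsOpen U) {z : ℂ}
    (hz : (z : Sphere) ∈ U) : ∃ a, (z : Sphere) ∈ basicSet a ∧ closure (basicSet a) ⊆ U := by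
  obtain ⟨δ, hδ, hsub⟩ := Metric.isOpen_iff.1 (hU.preimage OnePoint.continuous_coe) z hz
  obtain ⟨a, ha, hza, hw, hh⟩ := exists_small_rectangle z (show 0 < δ / 4 by linarith)
  refine ⟨a, hza, ?_⟩
  have hcl : IsClosed ((fun u : ℂ => (u : Sphere)) '' closedBall z (δ / 2)) :=
    ((isCompact_closedBall z (δ / 2)).image OnePoint.continuous_coe).isClosed
  refine (closure_minimal ?_ hcl).trans ?_
  · rw [basicSet_of_even ha] at hza ⊢
    rw [coe_mem_rectangle] at hza
    rintro _ ⟨u, ⟨h1, h2, h3, h4⟩, rfl⟩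
    refine mem_image_of_mem _ ?_
    rw [mem_closedBall, dist_eq_norm]
    refine (Complex.norm_le_abs_re_add_abs_im _).trans ?_
    have h5 : |(u - z).re| ≤ δ / 4 := by
      rw [Complex.sub_re, abs_le]; exact ⟨by linarith, by linarith⟩
    have h6 : |(u - z).im| ≤ δ / 4 := by
      rw [Complex.sub_im, abs_le]; exact ⟨by linarith, by linarith⟩
    linarith
  · rintro _ ⟨u, hu, rfl⟩
    exact hsub (closedBall_subset_ball (by linarith) hu)

section Certificates

variable {D C : Set Sphere} {f : Sphere → Sphere} {p n q r : ℕ → ℕ}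

/-- Soundness: a disk about m inside the basic set either leaves `D`, and then crosses the boundary,
or lies in `D`, and then the separation of the images contradicts the distortion bound. -/
theorem Certifies.inter_frontier_nonempty (hDo : IsOpen D) (hCo : IsOpen C) (hD : ∞ ∈ D)
    (hf : IsConformalMap f D C) (hinf : f ∞ = ∞) (hp : NamesOpen p D) (hq : NamesFun q D f)
    (hr : NamesClosed r (frontier C)) {N k m m' d e a i j i' j' t u t' u' : ℕ}
    (h : Certifies ((List.range N).map (join (join p n) (join q r)))
      k m m' d e a i j i' j' t u t' u') : (basicSet k ∩ frontier D).Nonempty := by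
  obtain ⟨c, X, hc0, hX, hc⟩ := hq
  obtain ⟨hd, ha, hma, hj, hsep, hsq, hx, hx', hy, hy', hsim, hsim'⟩ := h
  have hd' := join_join_four_mul_add_one p n q r 0
  rw [mul_zero, zero_add, eq_of_getElem?_map_range hd, hc0] at hd'
  subst hd'
  have ha' := eq_of_getElem?_map_range ha
  rw [join_join_four_mul] at ha'
  have hj' := eq_of_getElem?_map_range hj
  rw [join_join_four_mul_add_three] at hj'
  have hmD : (pointOf m : Sphere) ∈ D :=
    (hp a).2 ⟨i, ha'⟩ (subset_closure (squareTest_zero_iff.1 hma))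
  have hε : (0 : ℝ) < posRatOf e := by exact_mod_cast posRatOf_pos e
  set ε : ℝ := (posRatOf e : ℝ) with hε_def
  have hball : ∀ z ∈ ball (pointOf m) (4 * ε), (z : Sphere) ∈ basicSet k := by
    intro z hz
    rw [mem_ball_iff_norm] at hz
    refine hsq.coe_mem_basicSet ?_ ?_ <;> push_cast
    · exact (Complex.abs_re_le_norm (z - pointOf m)).trans hz.le
    · exact (Complex.abs_im_le_norm (z - pointOf m)).trans hz.le
  by_cases hsub : ∀ z ∈ ball (pointOf m) (4 * ε), (z : Sphere) ∈ D
  · exfalso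
    have hdist : dist (pointOf m') (pointOf m) ≤ 4 * ε / 2 := by
      rw [dist_eq_norm]
      refine (Complex.norm_le_abs_re_add_abs_im _).trans ?_
      rify at hx hx' hy hy'
      have h1 : |(pointOf m' - pointOf m).re| ≤ ε := by
        rw [Complex.sub_re, abs_le]
        simp only [pointOf]
        exact ⟨by linarith, by linarith⟩
      have h2 : |(pointOf m' - pointOf m).im| ≤ ε := by
        rw [Complex.sub_im, abs_le]
        simp only [pointOf]
        exact ⟨by linarith, by linarith⟩
      linarith
    -- The certificate does not assert that m' lies in `D`; the simulated output at m' has a meaning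
    -- only under the present assumption that the whole disk does.
    have hm'D : (pointOf m' : Sphere) ∈ D := hsub _ (by rw [mem_ball]; linarith)
    have h1 := mem_basicSet_of_simulate hX hc hmD hsim
    have h2 := mem_basicSet_of_simulate hX hc hm'D hsim'
    obtain ⟨w, hwj, hwC⟩ := (hr j).2 ⟨i', hj'⟩
    rw [hCo.frontier_eq] at hwC
    have hwne : w ≠ ∞ := by
      rintro rfl
      exact hwC.2 (hinf ▸ hf.2.mapsTo hD)
    obtain ⟨ω, rfl⟩ := OnePoint.ne_infty_iff_exists.1 hwne
    rw [hf.map_coe hD hinf hmD] at h1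
    rw [hf.map_coe hD hinf hm'D] at h2
    have hlt := hsep.mul_norm_lt hwj h1 h2
    have hle := hf.norm_sub_le hD hinf (by positivity) hsub hwC.2 hdist
    have hK : Real.exp 16 + 1 ≤ distortionBound := Nat.le_ceil _
    have := mul_le_mul_of_nonneg_right hK (norm_nonneg (planeMap f (pointOf m) - ω))
    linarith
  · push Not at hsub
    obtain ⟨z, hz, hzD⟩ := hsub
    obtain ⟨v, hv, hvD⟩ := exists_mem_ball_frontier hDo hmD hz hzD
    exact ⟨v, hball v hv, hvD⟩

/-- Completeness: the order of choices matters. First m' is fixed, then the rectangles separating ω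
from its image, and only then m with image in the rectangle of ω. -/
theorem exists_certifies (hDo : IsOpen D) (hCo : IsOpen C) (hD : ∞ ∈ D)
    (hf : IsConformalMap f D C) (hinf : f ∞ = ∞) (hp : NamesOpen p D) (hq : NamesFun q D f)
    (hr : NamesClosed r (frontier C)) {k : ℕ} (hk : (basicSet k ∩ frontier D).Nonempty) :
    ∃ N m m' d e a i j i' j' t u t' u', Certifies ((List.range N).map (join (join p n) (join q r)))
      k m m' d e a i j i' j' t u t' u' := by
  obtain ⟨c, X, hc0, hX, hc⟩ := hq
  obtain ⟨w, hwk, hwD⟩ := hk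
  have hwne : w ≠ ∞ := by
    rintro rfl
    rw [hDo.frontier_eq] at hwD
    exact hwD.2 hD
  obtain ⟨ζ, rfl⟩ := OnePoint.ne_infty_iff_exists.1 hwne
  obtain ⟨ω, hωC, hω⟩ := hf.exists_mapClusterPt hDo hCo hD hinf hwD
  obtain ⟨δ, hδ, hδk⟩ := exists_squareTest_of_mem hwk
  obtain ⟨ε, hε0, hεδ⟩ := exists_rat_btwn (show (0 : ℝ) < δ / 4 by linarith)
  obtain ⟨e, rfl⟩ := exists_posRatOf_eq (show 0 < ε by exact_mod_cast hε0)
  set ε : ℝ := (posRatOf e : ℝ) with hε_def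
  -- Radius ε/2 about ζ for both points makes their coordinates differ by less than ε, and 4ε < δ
  -- leaves room for the square test.
  obtain ⟨m', hm', hm'D, -⟩ := hf.exists_pointOf_of_mapClusterPt hDo hω
    (isOpen_ball (x := ζ) (ε := ε / 2)) (mem_ball_self (by linarith)) isOpen_univ (mem_univ _)
  have hne : ω ≠ planeMap f (pointOf m') := by
    rintro rfl
    rw [hCo.frontier_eq, ← hf.map_coe hD hinf hm'D] at hωC
    exact hωC.2 (hf.2.mapsTo hm'D)
  obtain ⟨j, j', hωj, hj', hsep⟩ := exists_separationTest distortionBound hne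
  rw [← hf.map_coe hD hinf hm'D] at hj'
  obtain ⟨m, hm, hmD, hmj⟩ := hf.exists_pointOf_of_mapClusterPt hDo hω
    (isOpen_ball (x := ζ) (ε := ε / 2)) (mem_ball_self (by linarith)) (isOpen_basicSet j) hωj
  obtain ⟨i', hi'⟩ := (hr j).1 ⟨ω, hωj, hωC⟩
  obtain ⟨a, hma, haD⟩ := exists_basicSet_closure_subset hDo hmD
  obtain ⟨i, hi⟩ := (hp a).1 haD
  obtain ⟨u, hu⟩ := exists_simulate_of_mem_basicSet (p := p) (n := n) (r := r) hX hc hmD hmj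
  obtain ⟨u', hu'⟩ := exists_simulate_of_mem_basicSet (p := p) (n := n) (r := r) hX hc hm'D hj'
  -- One prefix length serves both simulations and the three tape cells consulted.
  obtain ⟨N, ⟨t, ht⟩, ⟨t', ht'⟩, h1, h2, h3⟩ := (hu.and (hu'.and
    ((eventually_getElem?_map_range (join (join p n) (join q r)) (4 * 0 + 1)).and
      ((eventually_getElem?_map_range (join (join p n) (join q r)) (4 * i)).and
        (eventually_getElem?_map_range (join (join p n) (join q r)) (4 * i' + 3)))))).exists
  rw [join_join_four_mul_add_one, hc0] at h1
  rw [join_join_four_mul, hi] at h2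
  rw [join_join_four_mul_add_three, hi'] at h3
  rw [mem_ball_iff_norm] at hm hm'
  have b1 := abs_lt.1 ((Complex.abs_re_le_norm _).trans_lt hm)
  have b2 := abs_lt.1 ((Complex.abs_im_le_norm _).trans_lt hm)
  have b3 := abs_lt.1 ((Complex.abs_re_le_norm _).trans_lt hm')
  have b4 := abs_lt.1 ((Complex.abs_im_le_norm _).trans_lt hm')
  simp only [Complex.sub_re, Complex.sub_im, pointOf] at b1 b2 b3 b4
  refine ⟨N, m, m', c.encode, e, a, i, j, i', j', t, u, t', u', h1, h2,
    squareTest_zero_iff.2 hma, h3, hsep, hδk _ _ _ ?_ ?_ ?_, ?_, ?_, ?_, ?_, ht, ht'⟩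
  · rw [abs_lt]; exact ⟨by linarith, by linarith⟩
  · rw [abs_lt]; exact ⟨by linarith, by linarith⟩
  · push_cast
    rw [abs_of_pos (by linarith)]
    linarith
  all_goals
    rify
    linarith

end Certificates

/-! ### The machine -/

open Classical in
/-- The list `v` of numbers is tested for being a certificate, by the initial segment `L` of the
input, for its first entry. -/
noncomputable def certifiedCode (v L : List ℕ) : ℕ :=
  if Certifies L (v.getD 0 0) (v.getD 1 0) (v.getD 2 0) (v.getD 3 0) (v.getD 4 0) (v.getD 5 0)
    (v.getD 6 0) (v.getD 7 0) (v.getD 8 0) (v.getD 9 0) (v.getD 10 0) (v.getD 11 0) (v.getD 12 0)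
    (v.getD 13 0) then v.getD 0 0 + 1 else 0

/-- The content of the output cell `k`, when the initial segment `L` of the input is known. -/
noncomputable def outputCell (k : ℕ) (L : List ℕ) : ℕ :=
  certifiedCode ((Encodable.decode (α := List ℕ) k.unpair.2).getD []) L

open Classical in
theorem primrec₂_outputCell : Primrec₂ outputCell := by
  have hv : Primrec fun a : ℕ × List ℕ =>
      (Encodable.decode (α := List ℕ) a.1.unpair.2).getD [] :=
    Primrec.option_getD.comp (Primrec.decode.comp (primrec_unpair_snd .fst)) (.const [])
  have hf : ∀ i : ℕ, Primrec fun a : ℕ × List ℕ =>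
      ((Encodable.decode (α := List ℕ) a.1.unpair.2).getD []).getD i 0 := fun i =>
    (Primrec.list_getD 0).comp hv (.const i)
  have hcell : ∀ {i : ℕ × List ℕ → ℕ}, Primrec i → Primrec fun a : ℕ × List ℕ => a.2[i a]? :=
    fun hi => Primrec.list_getElem?.comp .snd hi
  have hsome : ∀ i : ℕ, Primrec fun a : ℕ × List ℕ =>
      some (((Encodable.decode (α := List ℕ) a.1.unpair.2).getD []).getD i 0 + 1) := fun i =>
    Primrec.option_some.comp (Primrec.succ.comp (hf i))
  have hX := fun i => RatPrimrec.ratOf (primrec_unpair_fst (hf i))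
  have hY := fun i => RatPrimrec.ratOf (primrec_unpair_snd (hf i))
  have hE := RatPrimrec.posRatOf (hf 4)
  have h0 : RatPrimrec fun _ : ℕ × List ℕ => (0 : ℚ) := by
    exact_mod_cast RatPrimrec.natCast 0
  have hmul4 : ∀ i, Primrec fun a : ℕ × List ℕ =>
      4 * ((Encodable.decode (α := List ℕ) a.1.unpair.2).getD []).getD i 0 := fun i =>
    Primrec.nat_mul.comp (.const 4) (hf i)
  refine .ite ?_ (Primrec.succ.comp (hf 0)) (.const 0)
  refine .and (Primrec.eq.comp (hcell (.const 1)) (Primrec.option_some.comp (hf 3))) ?_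
  refine .and (Primrec.eq.comp (hcell (hmul4 6)) (hsome 5)) ?_
  refine .and (primrecPred_squareTest (hX 1) (hY 1) h0 (hf 5)) ?_
  refine .and (Primrec.eq.comp (hcell (Primrec.nat_add.comp (hmul4 8) (.const 3))) (hsome 7)) ?_
  refine .and (primrecPred_separationTest _ (hf 7) (hf 9)) ?_
  refine .and (primrecPred_squareTest (hX 1) (hY 1) ((RatPrimrec.natCast 4).mul hE) (hf 0)) ?_
  refine .and (((hX 1).sub (hX 2)).lt hE) (.and (((hX 2).sub (hX 1)).lt hE)
    (.and (((hY 1).sub (hY 2)).lt hE) (.and (((hY 2).sub (hY 1)).lt hE) (.and ?_ ?_))))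
  · exact Primrec.eq.comp (primrec_simulate.comp (.pair (.pair (hf 1) .snd)
      (.pair (hf 10) (.pair (hf 3) (hf 11))))) (hsome 7)
  · exact Primrec.eq.comp (primrec_simulate.comp (.pair (.pair (hf 2) .snd)
      (.pair (hf 12) (.pair (hf 3) (hf 13))))) (hsome 9)

/-- Every pair of a prefix length and a list of candidates is a cell number, so each certificate is
tested in some cell. A failed test writes 0, which lists nothing; missing list entries are read as
0, and any tuple that passes is a genuine certificate. -/
theorem lists_outputCell {O : ℕ → ℕ} {S : Set ℕ}
    (h : ∀ k, k ∈ S ↔ ∃ N m m' d e a i j i' j' t u t' u',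
      Certifies ((List.range N).map O) k m m' d e a i j i' j' t u t' u') :
    Lists (fun k => outputCell k ((List.range k.unpair.1).map O)) S := by
  intro k
  rw [h]
  constructor
  · rintro ⟨N, m, m', d, e, a, i, j, i', j', t, u, t', u', hc⟩
    refine ⟨Nat.pair N (Encodable.encode [k, m, m', d, e, a, i, j, i', j', t, u, t', u']), ?_⟩
    simp only [outputCell, Nat.unpair_pair, Encodable.encodek, Option.getD_some]
    rw [certifiedCode]
    exact if_pos hc
  · rintro ⟨l, hl⟩
    simp only [outputCell, certifiedCode] at hl
    split_ifs at hl with hc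
    rw [Nat.succ.inj hl] at hc
    exact ⟨_, _, _, _, _, _, _, _, _, _, _, _, _, _, hc⟩

end SphereTTE

open scoped OnePoint in
/-- There are fixed machines that, from a name `p` of a non-degenerate `n`-connected domain `D`
with `∞ ∈ D` and `0 ∉ D`, the number `n`, a name `q` of `f_D` and a name `r` of the boundary of
`C_D`, write a name of the boundary of `D` and a name of the boundary of `C_D`. -/
theorem mainTheorem2 :
    ∃ c c' : SphereTTE.OracleCode,
      ∀ (D C : Set SphereTTE.Sphere) (f : SphereTTE.Sphere → SphereTTE.Sphere) (n : ℕ),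
        SphereTTE.IsSphereDomain D → SphereTTE.IsNConnected n D → SphereTTE.IsNondegenerate D →
        (∞ : SphereTTE.Sphere) ∈ D → ((0 : ℂ) : SphereTTE.Sphere) ∉ D →
        SphereTTE.IsKoebeMap D C f →
        ∀ p q r : ℕ → ℕ, SphereTTE.NamesOpen p D → SphereTTE.NamesFun q D f →
          SphereTTE.NamesClosed r (frontier C) →
          (∃ s, c.Writes (SphereTTE.join (SphereTTE.join p fun _ => n) (SphereTTE.join q r)) s ∧
            SphereTTE.NamesClosed s (frontier D)) ∧
          (∃ s, c'.Writes (SphereTTE.join (SphereTTE.join p fun _ => n) (SphereTTE.join q r)) s ∧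
            SphereTTE.NamesClosed s (frontier C)) := by
  obtain ⟨c, hc⟩ :=
    SphereTTE.OracleCode.exists_writes_of_primrec SphereTTE.primrec₂_outputCell
  -- The name r of the boundary of `C` occupies the cells 4k + 3 of the input, so the second machine
  -- only has to query them.
  obtain ⟨c', hc'⟩ := SphereTTE.OracleCode.exists_mem_eval_of_primrec
    (f := fun k => 4 * k + 3)
    (Primrec.nat_add.comp (Primrec.nat_mul.comp (.const 4) .id) (.const 3))
  refine ⟨c, .comp .oracle c', fun D C f n hDdom _ _ hD _ hK p q r hp hq hr => ⟨?_, r, ?_, hr⟩⟩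
  · have hinf := hK.2.2.map_infty (hK.2.1.1 ∞ hD).1
    refine ⟨_, hc _, SphereTTE.lists_outputCell fun k => ⟨fun hk => ?_, ?_⟩⟩
    · exact SphereTTE.exists_certifies hDdom.1 hK.1.1.1 hD hK.2.1 hinf hp hq hr hk
    · rintro ⟨N, m, m', d, e, a, i, j, i', j', t, u, t', u', h⟩
      exact h.inter_frontier_nonempty hDdom.1 hK.1.1.1 hD hK.2.1 hinf hp hq hr
  · intro k
    refine Part.eq_some_iff.2 (SphereTTE.OracleCode.mem_eval_comp.2 ⟨_, hc' _ k, ?_⟩)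
    rw [SphereTTE.OracleCode.mem_eval_oracle, SphereTTE.join_join_four_mul_add_three]
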